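/- Let $F,F'$ be fields, let $n\ge 1$, and let $V$ and $V'$ be $2n$-dimensional vector spaces over $F$ and $F'$ with non-degenerate symplectic (i.e. alternating bilinear) forms $\Omega:V\times V\to F$ and $\Omega':V'\times V'\to F'$. Let $\Pi$ and $\Pi'$ be the associated $(2n-1)$-dimensional projective spaces, with point sets $P$ and $P'$ (the $1$-dimensional subspaces of $V$ and $V'$). Two points $\langle x\rangle,\langle y\rangle$ of $\Pi$ are called orthogonal if $\Omega(x,y)=0$; a subspace of $\Pi$ is totally isotropic if any two of its points are orthogonal. A base of $\Pi$ (an independent set of points spanning $\Pi$) is called symplectic if each of its points is non-orthogonal to exactly one point of it. For $0\le k\le n-1$ let $\mathcal G_k$ be the set of all totally isotropic subspaces of $\Pi$ of projective dimension $k$. A base subset of $\mathcal G_k$ is the set of all elements of $\mathcal G_k$ spanned by points of $B$, for some symplectic base $B$ of $\Pi$. The same notions are used for $\Pi'$ and $\Omega'$, with $\mathcal G'_k$ in place of $\mathcal G_k$. An embedding of $\Pi$ to $\Pi'$ is an injection $h:P\to P'$ that maps every line of $\Pi$ to a subset of a line of $\Pi'$ and is such that every line of $\Pi'$ contains the image of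 at most one line of $\Pi$; an embedding is symplectic if it sends symplectic bases of $\Pi$ to symplectic bases of $\Pi'$. **Theorem.** Let $0\le k\le n-1$ and let $f:\mathcal G_k\to\mathcal G'_k$ be a map such that for every base subset $\mathcal B$ of $\mathcal G_k$ the image $f(\mathcal B)$ is a base subset of $\mathcal G'_k$. Then there is a symplectic embedding $h$ of $\Pi$ to $\Pi'$ that induces $f$: for every $S\in\mathcal G_k$, $f(S)$ is the subspace of $\Pi'$ spanned by $h(S)$. -/

import Mathlib

open scoped LinearAlgebra.Projectivization

namespace SymplecticGrassmannian

/-- The subspace (as a vector subspace) spanned by a set `X` of points of the projective space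
associated with `V`; a projective subspace of dimension `d` is a vector subspace of dimension
`d + 1`. -/
def pointSpan {F V : Type*} [Field F] [AddCommGroup V] [Module F V] (X : Set (ℙ F V)) :
    Submodule F V :=
  ⨆ p ∈ X, p.submodule

/-- The set of points of the projective space that lie on the subspace `S`. -/
def pointsOf {F V : Type*} [Field F] [AddCommGroup V] [Module F V] (S : Submodule F V) :
    Set (ℙ F V) :=
  {p | p.submodule ≤ S}

/-- A set of points is a line if it consists of all points on a two-dimensional vector subspace. -/
def IsLine {F V : Type*} [Field F] [AddCommGroup V] [Module F V] (L : Set (ℙ F V)) : Prop :=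
  ∃ W : Submodule F V, Module.finrank F W = 2 ∧ L = pointsOf W

/-- A base of the projective space: an independent set of points which spans the whole space. -/
def IsProjectiveBase {F V : Type*} [Field F] [AddCommGroup V] [Module F V]
    (B : Set (ℙ F V)) : Prop :=
  Projectivization.Independent (fun p : B => (p : ℙ F V)) ∧ pointSpan B = ⊤

/-- Orthogonality of two points with respect to the form `Ω`. -/
def PointOrthogonal {F V : Type*} [Field F] [AddCommGroup V] [Module F V]
    (Ω : LinearMap.BilinForm F V) (p q : ℙ F V) : Prop :=
  ∀ x ∈ p.submodule, ∀ y ∈ q.submodule, Ω x y = 0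

/-- A base is symplectic if every point of it is non-orthogonal to precisely one point of it. -/
def IsSymplecticBase {F V : Type*} [Field F] [AddCommGroup V] [Module F V]
    (Ω : LinearMap.BilinForm F V) (B : Set (ℙ F V)) : Prop :=
  IsProjectiveBase B ∧ ∀ p ∈ B, ∃! q, q ∈ B ∧ ¬ PointOrthogonal Ω p q

/-- A subspace is totally isotropic if any two points of it are orthogonal. -/
def IsTotallyIsotropic {F V : Type*} [Field F] [AddCommGroup V] [Module F V]
    (Ω : LinearMap.BilinForm F V) (S : Submodule F V) : Prop :=
  ∀ p ∈ pointsOf S, ∀ q ∈ pointsOf S, PointOrthogonal Ω p q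

/-- The Grassmannian of totally isotropic subspaces of projective dimension `k`
(that is, of vector space dimension `k + 1`). -/
def Grassmannian {F V : Type*} [Field F] [AddCommGroup V] [Module F V]
    (Ω : LinearMap.BilinForm F V) (k : ℕ) : Type _ :=
  {S : Submodule F V // Module.finrank F S = k + 1 ∧ IsTotallyIsotropic Ω S}

/-- The set of all elements of the Grassmannian that are spanned by points of `B`. -/
def baseSubset {F V : Type*} [Field F] [AddCommGroup V] [Module F V]
    (Ω : LinearMap.BilinForm F V) (k : ℕ) (B : Set (ℙ F V)) : Set (Grassmannian Ω k) :=
  {S | ∃ A : Set (ℙ F V), A ⊆ B ∧ S.1 = pointSpan A}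

/-- Base subsets of the Grassmannian: those defined by symplectic bases. -/
def IsBaseSubset {F V : Type*} [Field F] [AddCommGroup V] [Module F V]
    (Ω : LinearMap.BilinForm F V) (k : ℕ) (X : Set (Grassmannian Ω k)) : Prop :=
  ∃ B : Set (ℙ F V), IsSymplecticBase Ω B ∧ X = baseSubset Ω k B

/-- Embeddings of projective spaces: injections of the point sets mapping lines to subsets of
lines and such that every line contains the image of at most one line. -/
def IsEmbedding {F V F' V' : Type*} [Field F] [AddCommGroup V] [Module F V]
    [Field F'] [AddCommGroup V'] [Module F' V'] (h : ℙ F V → ℙ F' V') : Prop :=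
  Function.Injective h ∧
  (∀ L : Set (ℙ F V), IsLine L → ∃ L' : Set (ℙ F' V'), IsLine L' ∧ h '' L ⊆ L') ∧
  (∀ L' : Set (ℙ F' V'), IsLine L' → ∀ L₁ L₂ : Set (ℙ F V), IsLine L₁ → IsLine L₂ →
    h '' L₁ ⊆ L' → h '' L₂ ⊆ L' → L₁ = L₂)

/-- Symplectic embeddings: embeddings sending symplectic bases to symplectic bases. -/
def IsSymplecticEmbedding {F V F' V' : Type*} [Field F] [AddCommGroup V] [Module F V]
    [Field F'] [AddCommGroup V'] [Module F' V'] (Ω : LinearMap.BilinForm F V)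
    (Ω' : LinearMap.BilinForm F' V') (h : ℙ F V → ℙ F' V') : Prop :=
  IsEmbedding h ∧ ∀ B : Set (ℙ F V), IsSymplecticBase Ω B → IsSymplecticBase Ω' (h '' B)

/-- The map `f` of Grassmannians is induced by the point map `h`: it sends every `S` to the
subspace spanned by the image under `h` of the set of points of `S`. -/
def IsInducedBy {F V F' V' : Type*} [Field F] [AddCommGroup V] [Module F V]
    [Field F'] [AddCommGroup V'] [Module F' V'] {Ω : LinearMap.BilinForm F V}
    {Ω' : LinearMap.BilinForm F' V'} {k : ℕ} (f : Grassmannian Ω k → Grassmannian Ω' k)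
    (h : ℙ F V → ℙ F' V') : Prop :=
  ∀ S : Grassmannian Ω k, (f S).1 = pointSpan (h '' pointsOf S.1)

end SymplecticGrassmannian

/-!
A symplectic base with its matching of non-orthogonal points is encoded as a *frame*: vectors
indexed by the vertices `Fin n × Bool` of the cross-polytope, of which exactly the antipodal ones
are non-orthogonal. The base subset of a frame is then a copy of the set of `k`-dimensional faces of
the cross-polytope, and `f` restricts to a permutation `σ` of faces between a frame of `V` and a
frame of `V'`.

The main point is that `σ` is induced by a permutation of vertices that commutes with the antipodal
map. The faces of a frame that are not spanned by vectors of a second frame form a union of sets of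
two kinds: the faces through a vertex `r` (`star k r`), and the faces that contain `r` but not `s`,
or `antip s` but not `antip r` (`separating k r s`); see `IsFrame.isUnionOfGenerating_notMem_range`.
Each set of these kinds arises from a triple of frames (`IsTriple`), in which a modification of one
or two vectors replaces one part of the base subset. Applying `f` to the three base subsets shows
that `σ` maps the sets of both kinds to unions of such sets. By finiteness the same holds for the
inverse of `σ`, so `σ` permutes the minimal sets of these kinds. The triples also show that `σ`
preserves opposition of faces (`PermutesFaces.apply_opp`): an opposite pair in the image cannot have
exactly one member in the common part of the three base subsets. If the faces are not facets, stars
are distinguished from separating sets by the number of sets of these kinds disjoint from them; for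
facets of positive dimension the minimal sets consist of all facets through two given vertices, and
stars are recovered with the help of opposition. So `σ` permutes the stars, hence comes from the
vertices (`exists_perm_vertices`); it commutes with the antipodal map because stars of antipodal
vertices are the disjoint ones if `k > 0`, and because of opposition if `k = 0`.

Thus `f` is induced by a bijection of frames on every base subset
(`PermutesFaces.inducedOnFrames`). Consequently it respects adjacency, and a map induced in this way
descends from one dimension to the previous one: all subspaces through `H` have images through one
subspace of the dimension of `H` (`InducedOnFrames.exists_le`). Repeated descent ends with a map of
points that sends frames to frames. Any two points belong to a frame, so this map preserves
orthogonality and non-orthogonality. A line is determined by orthogonality to all but two vectors of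
a frame, which makes the map an embedding (`MapsFrames.isSymplecticEmbedding`).
-/

namespace SymplecticGrassmannian

/-! ### The cross-polytope and its faces -/

/-- The antipodal vertex of a vertex of the cross-polytope with vertex set `Fin n × Bool`. -/
def antip {n : ℕ} (r : Fin n × Bool) : Fin n × Bool := (r.1, !r.2)

@[simp] lemma antip_antip {n : ℕ} (r : Fin n × Bool) : antip (antip r) = r := by
  simp [antip]

lemma antip_ne {n : ℕ} (r : Fin n × Bool) : antip r ≠ r := by
  intro h
  have := congrArg Prod.snd h
  simp [antip] at this

lemma ne_antip {n : ℕ} (r : Fin n × Bool) : r ≠ antip r := (antip_ne r).symm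

@[simp] lemma antip_inj {n : ℕ} {r s : Fin n × Bool} : antip r = antip s ↔ r = s :=
  ⟨fun h => by simpa using congrArg antip h, congrArg antip⟩

lemma antip_eq_comm {n : ℕ} {r s : Fin n × Bool} : antip r = s ↔ antip s = r :=
  ⟨fun h => by rw [← h, antip_antip], fun h => by rw [← h, antip_antip]⟩

lemma eq_or_eq_antip {n : ℕ} {r s : Fin n × Bool} (h : s.1 = r.1) : s = r ∨ s = antip r := by
  rcases r with ⟨i, b⟩
  rcases s with ⟨j, c⟩
  simp only at h
  subst h
  cases b <;> cases c <;> simp [antip]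

/-- The `k`-dimensional faces of the cross-polytope with vertex set `Fin n × Bool`: the sets of
`k + 1` vertices without antipodal pairs. -/
def Face (n k : ℕ) : Type :=
  {A : Finset (Fin n × Bool) // A.card = k + 1 ∧ ∀ r ∈ A, antip r ∉ A}

noncomputable instance (n k : ℕ) : Fintype (Face n k) :=
  inferInstanceAs (Fintype {A : Finset (Fin n × Bool) // A.card = k + 1 ∧ ∀ r ∈ A, antip r ∉ A})

namespace Face

variable {n k : ℕ}

lemma eq_of_subset {A B : Face n k} (h : A.1 ⊆ B.1) : A = B :=
  Subtype.ext (Finset.eq_of_subset_of_card_le h (by rw [A.2.1, B.2.1]))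

lemma nonempty (A : Face n k) : A.1.Nonempty := by
  rw [← Finset.card_pos, A.2.1]; omega

lemma mem_or_of_card (h : k + 1 = n) (A : Face n k) (r : Fin n × Bool) :
    r ∈ A.1 ∨ antip r ∈ A.1 := by
  have hinj : Set.InjOn (Prod.fst : Fin n × Bool → Fin n) A.1 := by
    intro x hx y hy hxy
    rcases eq_or_eq_antip hxy with h | h
    · exact h
    · exact absurd (h ▸ hx) (A.2.2 y hy)
  have hcard : (A.1.image Prod.fst).card = n := by
    rw [Finset.card_image_of_injOn hinj, A.2.1, h]
  have huniv : A.1.image Prod.fst = Finset.univ := by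
    rw [← Finset.card_eq_iff_eq_univ, hcard, Fintype.card_fin]
  have : r.1 ∈ A.1.image Prod.fst := huniv ▸ Finset.mem_univ _
  obtain ⟨s, hs, hsr⟩ := Finset.mem_image.1 this
  rcases eq_or_eq_antip hsr with h | h
  · exact Or.inl (h ▸ hs)
  · exact Or.inr (h ▸ hs)

/-- The face opposite to a given face. -/
def opp (A : Face n k) : Face n k :=
  ⟨A.1.image antip, by
    rw [Finset.card_image_of_injective _ (fun r s h => antip_inj.1 h)]
    exact A.2.1, by
    intro r hr h
    obtain ⟨s, hs, rfl⟩ := Finset.mem_image.1 hr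
    obtain ⟨t, ht, h⟩ := Finset.mem_image.1 h
    rw [antip_antip] at h
    exact A.2.2 t ht (h ▸ hs)⟩

@[simp] lemma mem_opp {A : Face n k} {r : Fin n × Bool} : r ∈ A.opp.1 ↔ antip r ∈ A.1 := by
  refine ⟨fun h => ?_, fun h => ?_⟩
  · obtain ⟨s, hs, rfl⟩ := Finset.mem_image.1 h
    simpa using hs
  · exact Finset.mem_image.2 ⟨_, h, antip_antip r⟩

@[simp] lemma opp_opp (A : Face n k) : A.opp.opp = A := by
  apply Subtype.ext
  ext r
  simp

lemma opp_ne (A : Face n k) : A.opp ≠ A := by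
  intro h
  obtain ⟨r, hr⟩ := A.nonempty
  have : antip r ∈ A.opp.1 := by simpa using hr
  rw [h] at this
  exact A.2.2 r hr this

lemma antip_not_mem {A : Face n k} {r : Fin n × Bool} (h : antip r ∈ A.1) : r ∉ A.1 :=
  fun h' => A.2.2 r h' h

/-- Two non-antipodal vertices lie on a face which avoids two further vertices. -/
lemma exists_mem_not_mem {x y z w : Fin n × Bool} (hxy : y ≠ antip x) (hzx : z ≠ x) (hzy : z ≠ y)
    (hwx : w ≠ x) (hwy : w ≠ y) (hc : ({x, y} : Finset (Fin n × Bool)).card ≤ k + 1)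
    (hkn : k + 1 < n ∨ (k < n ∧ w ≠ antip z)) :
    ∃ A : Face n k, x ∈ A.1 ∧ y ∈ A.1 ∧ z ∉ A.1 ∧ w ∉ A.1 := by
  classical
  -- a transversal through `x` and `y` which avoids `z`, and `w` unless it is antipodal to `z`
  let e : Fin n → Bool := fun i =>
    if i = x.1 then x.2 else if i = y.1 then y.2 else if i = z.1 then !z.2
    else !w.2
  let T : Finset (Fin n × Bool) := Finset.univ.image (fun i => (i, e i))
  have hT : ∀ r, r ∈ T ↔ r.2 = e r.1 := by
    intro r
    simp only [T, Finset.mem_image, Finset.mem_univ, true_and]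
    constructor
    · rintro ⟨i, rfl⟩; rfl
    · intro h; exact ⟨r.1, Prod.ext rfl h.symm⟩
  have hTc : T.card = n := by
    rw [Finset.card_image_of_injective _ (fun i j h => congrArg Prod.fst h)]
    simp
  have hxT : x ∈ T := by rw [hT]; simp [e]
  have hyT : y ∈ T := by
    rw [hT]
    by_cases h : y.1 = x.1
    · rcases eq_or_eq_antip h with h' | h'
      · subst h'; simp [e]
      · exact absurd h' hxy
    · simp [e, h]
  have hzT : z ∉ T := by
    rw [hT]
    by_cases h : z.1 = x.1
    · rcases eq_or_eq_antip h with h' | h'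
      · exact absurd h' hzx
      · subst h'; simp [e, antip]
    · by_cases h2 : z.1 = y.1
      · rcases eq_or_eq_antip h2 with h' | h'
        · exact absurd h' hzy
        · subst h'
          simp only [antip] at h ⊢
          simp [e, h]
      · simp [e, h, h2]
  have hsub : ({x, y} : Finset (Fin n × Bool)) ⊆ T.erase w := by
    intro r hr
    rw [Finset.mem_insert, Finset.mem_singleton] at hr
    rcases hr with rfl | rfl
    · exact Finset.mem_erase.2 ⟨hwx.symm, hxT⟩
    · exact Finset.mem_erase.2 ⟨hwy.symm, hyT⟩
  have hle : k + 1 ≤ (T.erase w).card := by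
    rcases hkn with h | ⟨h, hwz⟩
    · have := Finset.pred_card_le_card_erase (s := T) (a := w)
      omega
    · have hwT : w ∉ T := by
        rw [hT]
        by_cases h : w.1 = x.1
        · rcases eq_or_eq_antip h with h' | h'
          · exact absurd h' hwx
          · subst h'; simp [e, antip]
        · by_cases h2 : w.1 = y.1
          · rcases eq_or_eq_antip h2 with h' | h'
            · exact absurd h' hwy
            · subst h'
              simp only [antip] at h ⊢
              simp [e, h]
          · by_cases h3 : w.1 = z.1
            · rcases eq_or_eq_antip h3 with h' | h'
              · subst h'
                exact fun h => hzT ((hT _).2 h)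
              · exact absurd h' hwz
            · simp [e, h, h2, h3]
      rw [Finset.erase_eq_of_notMem hwT, hTc]; omega
  obtain ⟨A, hA1, hA2, hA3⟩ := Finset.exists_subsuperset_card_eq hsub hc hle
  refine ⟨⟨A, hA3, ?_⟩, hA1 (by simp), hA1 (by simp), ?_, ?_⟩
  · intro r hr hr'
    have h1 := (hT _).1 (Finset.mem_of_mem_erase (hA2 hr))
    have h2 := (hT _).1 (Finset.mem_of_mem_erase (hA2 hr'))
    simp only [antip] at h2
    rw [← h1] at h2
    simp at h2
  · exact fun h => hzT (Finset.mem_of_mem_erase (hA2 h))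
  · exact fun h => Finset.notMem_erase w T (hA2 h)

lemma exists_mem {x y : Fin n × Bool} (hxy : y ≠ antip x)
    (hc : ({x, y} : Finset (Fin n × Bool)).card ≤ k + 1) (hkn : k < n) :
    ∃ A : Face n k, x ∈ A.1 ∧ y ∈ A.1 := by
  have hz : antip x ≠ y := hxy.symm
  obtain ⟨A, h1, h2, -⟩ := exists_mem_not_mem (z := antip x) (w := antip x) hxy (antip_ne x) hz
    (antip_ne x) hz hc (Or.inr ⟨hkn, ne_antip _⟩)
  exact ⟨A, h1, h2⟩

end Face

/-- The set of faces which contain a given vertex. -/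
def star {n : ℕ} (k : ℕ) (r : Fin n × Bool) : Set (Face n k) := {A | r ∈ A.1}

/-- The set of faces which separate `r` from `s`, or `antip s` from `antip r`. -/
def separating {n : ℕ} (k : ℕ) (r s : Fin n × Bool) : Set (Face n k) :=
  {A | (r ∈ A.1 ∧ s ∉ A.1) ∨ (antip s ∈ A.1 ∧ antip r ∉ A.1)}

/-- The sets of faces `star k r` and `separating k r s` with `s` different from `r` and its
antipode. -/
def IsGenerating {n k : ℕ} (X : Set (Face n k)) : Prop :=
  (∃ r, X = star k r) ∨ ∃ r s, s ≠ r ∧ s ≠ antip r ∧ X = separating k r s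

/-- The unions of generating sets. -/
def IsUnionOfGenerating {n k : ℕ} (X : Set (Face n k)) : Prop :=
  ∀ A ∈ X, ∃ Y, IsGenerating Y ∧ A ∈ Y ∧ Y ⊆ X

section

variable {n k : ℕ}

lemma mem_star {r : Fin n × Bool} {A : Face n k} : A ∈ star k r ↔ r ∈ A.1 := Iff.rfl

lemma mem_separating {r s : Fin n × Bool} {A : Face n k} :
    A ∈ separating k r s ↔ (r ∈ A.1 ∧ s ∉ A.1) ∨ (antip s ∈ A.1 ∧ antip r ∉ A.1) := Iff.rfl

lemma separating_antip (r s : Fin n × Bool) :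
    separating k (antip s) (antip r) = separating k r s := by
  ext A
  simp only [mem_separating, antip_antip]
  exact or_comm

lemma star_isGenerating (r : Fin n × Bool) : IsGenerating (star k r) := Or.inl ⟨r, rfl⟩

lemma separating_isGenerating {r s : Fin n × Bool} (h : s ≠ r) (h' : s ≠ antip r) :
    IsGenerating (separating k r s) := Or.inr ⟨r, s, h, h', rfl⟩

lemma IsGenerating.isUnion {X : Set (Face n k)} (h : IsGenerating X) : IsUnionOfGenerating X :=
  fun _ hA => ⟨X, h, hA, subset_rfl⟩

lemma pair_card_le (hk : 1 ≤ k) (x y : Fin n × Bool) :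
    ({x, y} : Finset (Fin n × Bool)).card ≤ k + 1 :=
  (Finset.card_le_two).trans (by omega)

lemma IsGenerating.nonempty (hk : 1 ≤ k) (hkn : k < n) {X : Set (Face n k)}
    (h : IsGenerating X) : X.Nonempty := by
  rcases h with ⟨r, rfl⟩ | ⟨r, s, h1, h2, rfl⟩
  · obtain ⟨A, hA, -⟩ := Face.exists_mem (k := k) (ne_antip r) (pair_card_le hk r r) hkn
    exact ⟨A, hA⟩
  · obtain ⟨A, hA, hA'⟩ := Face.exists_mem (k := k) (x := r) (y := antip s)
      (fun h => h1 (antip_inj.1 h)) (pair_card_le hk _ _) hkn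
    exact ⟨A, Or.inl ⟨hA, Face.antip_not_mem hA'⟩⟩

lemma separating_disjoint (r s : Fin n × Bool) :
    Disjoint (separating k r s) (separating k s r) := by
  rw [Set.disjoint_left]
  rintro A (⟨h1, h2⟩ | ⟨h1, h2⟩) (⟨h3, h4⟩ | ⟨h3, h4⟩)
  · exact h2 h3
  · exact Face.antip_not_mem h3 h1
  · exact Face.antip_not_mem h1 h3
  · exact h2 h3

/-! ### Permutations of faces that preserve unions of generating sets -/

variable {σ : Equiv.Perm (Face n k)}

lemma image_isUnion (hσ : ∀ X, IsGenerating X → IsUnionOfGenerating (σ '' X))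
    {X : Set (Face n k)} (hX : IsUnionOfGenerating X) : IsUnionOfGenerating (σ '' X) := by
  rintro _ ⟨A, hA, rfl⟩
  obtain ⟨Y, hY, hAY, hYX⟩ := hX A hA
  obtain ⟨Z, hZ, hAZ, hZY⟩ := hσ Y hY (σ A) ⟨A, hAY, rfl⟩
  exact ⟨Z, hZ, hAZ, hZY.trans (Set.image_mono hYX)⟩

/-- A permutation of a finite set that maps a finite family of subsets into itself permutes the
family, so its inverse preserves unions of generating sets as well. -/
lemma symm_image_isUnion (hσ : ∀ X, IsGenerating X → IsUnionOfGenerating (σ '' X))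
    {X : Set (Face n k)} (hX : IsUnionOfGenerating X) : IsUnionOfGenerating (σ.symm '' X) := by
  let g : {X : Set (Face n k) // IsUnionOfGenerating X} →
      {X : Set (Face n k) // IsUnionOfGenerating X} := fun X => ⟨σ '' X.1, image_isUnion hσ X.2⟩
  have hg : Function.Injective g := by
    intro X Y h
    exact Subtype.ext (σ.injective.image_injective (congrArg Subtype.val h))
  obtain ⟨⟨Y, hY⟩, hYX⟩ := (Finite.injective_iff_surjective.1 hg) ⟨X, hX⟩
  have : σ '' Y = X := congrArg Subtype.val hYX
  rw [← this, Equiv.symm_image_image]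
  exact hY

/-- A generating set that contains no smaller one. -/
def IsMinGenerating (X : Set (Face n k)) : Prop :=
  IsGenerating X ∧ ∀ Y, IsGenerating Y → Y ⊆ X → Y = X

lemma IsMinGenerating.image (hk : 1 ≤ k) (hkn : k < n)
    (hσ : ∀ X, IsGenerating X → IsUnionOfGenerating (σ '' X))
    {X : Set (Face n k)} (hX : IsMinGenerating X) : IsMinGenerating (σ '' X) := by
  have key : ∀ Y, IsGenerating Y → Y ⊆ σ '' X → Y = σ '' X := by
    intro Y hY hYX
    obtain ⟨A, hA⟩ := hY.nonempty hk hkn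
    obtain ⟨Z, hZ, -, hZY⟩ := symm_image_isUnion hσ hY.isUnion (σ.symm A) ⟨A, hA, rfl⟩
    have hsub : σ.symm '' Y ⊆ X := by
      rintro _ ⟨B, hB, rfl⟩
      obtain ⟨C, hC, rfl⟩ := hYX hB
      simpa using hC
    have hZX := hX.2 Z hZ (hZY.trans hsub)
    have : σ.symm '' Y = X := hsub.antisymm (hZX ▸ hZY)
    rw [← this, Equiv.image_symm_image]
  obtain ⟨A, hA⟩ := hX.1.nonempty hk hkn
  obtain ⟨Y, hY, -, hYX⟩ := hσ X hX.1 (σ A) ⟨A, hA, rfl⟩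
  refine ⟨?_, key⟩
  rw [← key Y hY hYX]
  exact hY

/-! ### Faces which are not facets -/

/-- If faces are not facets, only few generating sets are disjoint from `separating k a b`. -/
lemma eq_of_disjoint_separating (hk : 1 ≤ k) (hkn : k + 1 < n) {a b : Fin n × Bool} (h1 : b ≠ a)
    (h2 : b ≠ antip a) {Y : Set (Face n k)} (hY : IsGenerating Y)
    (hd : Disjoint Y (separating k a b)) :
    Y = star k b ∨ Y = star k (antip a) ∨ Y = separating k b a := by
  rw [Set.disjoint_left] at hd
  have h1' := h1.symm
  have hba : antip b ≠ antip a := fun h => h1 (antip_inj.1 h)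
  rcases hY with ⟨u, rfl⟩ | ⟨u, v, h3, h4, rfl⟩
  · by_contra! hne
    obtain ⟨hu1, hu2, -⟩ := hne
    have hu1 : u ≠ b := fun h => hu1 (h ▸ rfl)
    have hu2 : u ≠ antip a := fun h => hu2 (h ▸ rfl)
    have hab : antip b ≠ a := fun h => h2 (antip_eq_comm.1 h).symm
    by_cases hu : u = antip b
    · obtain ⟨A, hA1, -, hA2, hA3⟩ := Face.exists_mem_not_mem (k := k) (x := antip b)
        (y := antip b) (z := a) (w := antip a) (ne_antip _) hab.symm hab.symm hba.symm hba.symm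
        (pair_card_le hk _ _) (Or.inl hkn)
      exact hd (a := A) (by rw [mem_star, hu]; exact hA1) (Or.inr ⟨hA1, hA3⟩)
    · obtain ⟨A, hA1, hA2, hA3, hA4⟩ := Face.exists_mem_not_mem (k := k) (x := a)
        (y := u) (z := b) (w := antip b) hu2 h1 (Ne.symm hu1) hab (Ne.symm hu)
        (pair_card_le hk _ _) (Or.inl hkn)
      exact hd (a := A) hA2 (Or.inl ⟨hA1, hA3⟩)
  · have key : ∀ u v a b : Fin n × Bool, v ≠ u → b ≠ a → (∀ ⦃A : Face n k⦄,
        A ∈ separating k u v → A ∉ separating k a b) → u = antip a ∨ u = b ∨ v = a := by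
      intro u v a b h1 h3 hd
      by_contra! hne
      obtain ⟨hA, hB, hC⟩ := hne
      obtain ⟨A, hA1, hA2, hA3, hA4⟩ := Face.exists_mem_not_mem (k := k) (x := a)
        (y := u) (z := b) (w := v) hA h3 (Ne.symm hB) hC h1 (pair_card_le hk _ _) (Or.inl hkn)
      exact hd (A := A) (Or.inl ⟨hA2, hA4⟩) (Or.inl ⟨hA1, hA3⟩)
    have e1 := key u v a b h3 h1 hd
    have e2 := key u v (antip b) (antip a) h3 hba.symm (by rw [separating_antip]; exact hd)
    have e3 := key (antip v) (antip u) a b (fun h => h3 (antip_inj.1 h).symm) h1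
      (by rw [separating_antip]; exact hd)
    have e4 := key (antip v) (antip u) (antip b) (antip a) (fun h => h3 (antip_inj.1 h).symm)
      hba.symm (by rw [separating_antip, separating_antip]; exact hd)
    simp only [antip_antip, antip_inj] at e1 e2 e3 e4
    have e5 : antip a ≠ b := h2.symm
    have e6 : antip v = b ↔ v = antip b := by rw [antip_eq_comm]; exact eq_comm
    have e7 : antip u = a ↔ u = antip a := by rw [antip_eq_comm]; exact eq_comm
    rw [e6, e7] at e3
    have : (u = antip a ∧ v = antip b) ∨ (u = b ∧ v = a) := by grind
    rcases this with ⟨rfl, rfl⟩ | ⟨rfl, rfl⟩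
    · exact Or.inr (Or.inr (separating_antip _ _))
    · exact Or.inr (Or.inr rfl)

lemma isMinGenerating_of_lt (hk : 1 ≤ k) (hkn : k + 1 < n) {X : Set (Face n k)}
    (hX : IsGenerating X) : IsMinGenerating X := by
  refine ⟨hX, fun Y hY hYX => ?_⟩
  rcases hX with ⟨r, rfl⟩ | ⟨a, b, h1, h2, rfl⟩
  · rcases hY with ⟨u, rfl⟩ | ⟨u, v, h3, h4, rfl⟩
    · by_cases h : r = u
      · rw [h]
      · obtain ⟨A, hA1, -, hA2, -⟩ := Face.exists_mem_not_mem (k := k) (x := u)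
          (y := u) (z := r) (w := r) (ne_antip _) h h h h (pair_card_le hk _ _) (Or.inl hkn)
        exact absurd (hYX hA1) hA2
    · exfalso
      by_cases h : r = u
      · subst h
        have h5 : antip r ≠ antip v := fun h => h3 (antip_inj.1 h).symm
        have h6 : r ≠ antip v := fun h => h4 (antip_eq_comm.1 h.symm).symm
        obtain ⟨A, hA1, -, hA2, hA3⟩ := Face.exists_mem_not_mem (k := k) (x := antip v)
          (y := antip v) (z := antip r) (w := r) (ne_antip _) h5 h5 h6 h6 (pair_card_le hk _ _)
          (Or.inl hkn)
        exact hA3 (hYX (Or.inr ⟨hA1, hA2⟩))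
      · obtain ⟨A, hA1, -, hA2, hA3⟩ := Face.exists_mem_not_mem (k := k) (x := u)
          (y := u) (z := v) (w := r) (ne_antip _) h3 h3 h h (pair_card_le hk _ _) (Or.inl hkn)
        exact hA3 (hYX (Or.inl ⟨hA1, hA2⟩))
  · have hd : Disjoint Y (separating k b a) := (separating_disjoint a b).mono_left hYX
    have h3 : antip b ≠ antip a := fun h => h1 (antip_inj.1 h)
    rcases eq_of_disjoint_separating hk hkn h1.symm (fun h => h2 (antip_eq_comm.1 h.symm).symm)
      hY hd with rfl | rfl | rfl
    · exfalso
      obtain ⟨A, hA1, hA2⟩ := Face.exists_mem (k := k) (x := a) (y := b) h2 (pair_card_le hk _ _)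
        (by omega)
      rcases hYX hA1 with h | h
      · exact h.2 hA2
      · exact A.2.2 b hA2 h.1
    · exfalso
      obtain ⟨A, hA1, hA2⟩ := Face.exists_mem (k := k) (x := antip a) (y := antip b)
        (fun h => h2 (by simpa using (antip_eq_comm.1 h).symm)) (pair_card_le hk _ _)
        (by omega)
      rcases hYX (show A ∈ star k (antip b) from hA2) with h | h
      · exact Face.antip_not_mem hA1 h.1
      · exact h.2 hA1
    · rfl

lemma separating_left_injective (hk : 1 ≤ k) (hkn : k + 1 < n) {u u' r : Fin n × Bool}
    (h1 : r ≠ u) (h4 : r ≠ antip u')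
    (h : separating k u r = separating k u' r) : u = u' := by
  by_contra hne
  obtain ⟨A, hA1, hA2, hA3, -⟩ := Face.exists_mem_not_mem (k := k) (x := u) (y := antip u')
    (z := r) (w := r) (fun h => hne (antip_inj.1 h).symm) h1 h4 h1 h4 (pair_card_le hk _ _)
    (Or.inl hkn)
  have : A ∈ separating k u' r := h ▸ Or.inl ⟨hA1, hA3⟩
  rcases this with h | h
  · exact Face.antip_not_mem hA2 h.1
  · exact h.2 hA2

lemma image_star_of_lt (hk : 1 ≤ k) (hkn : k + 1 < n)
    (hσ : ∀ X, IsGenerating X → IsUnionOfGenerating (σ '' X)) (r : Fin n × Bool) :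
    ∃ r', σ '' star k r = star k r' := by
  classical
  have hgen : ∀ X, IsGenerating X → IsGenerating (σ '' X) := fun X hX =>
    ((isMinGenerating_of_lt hk hkn hX).image hk (by omega) hσ).1
  rcases hgen _ (star_isGenerating r) with h | ⟨a, b, h1, h2, h⟩
  · exact h
  exfalso
  -- at least four sets `separating k u r` are disjoint from `star k r`, but only three generating
  -- sets are disjoint from `separating k a b`
  let U := {u : Fin n × Bool // u.1 ≠ r.1}
  have hU : ∀ u : U, r ≠ u.1 ∧ r ≠ antip u.1 := fun u =>
    ⟨fun h => u.2 (congrArg Prod.fst h).symm, fun h => u.2 (congrArg Prod.fst h).symm⟩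
  let S : Finset (Set (Face n k)) := {star k b, star k (antip a), separating k b a}
  have hmaps : ∀ u : U, σ '' separating k u.1 r ∈ S := by
    intro u
    have hd : Disjoint (σ '' separating k u.1 r) (separating k a b) := by
      rw [← h, Set.disjoint_image_iff σ.injective, Set.disjoint_left]
      rintro A (⟨-, h⟩ | ⟨h, -⟩) h'
      · exact h h'
      · exact Face.antip_not_mem h h'
    have := eq_of_disjoint_separating hk hkn h1 h2
      (hgen _ (separating_isGenerating (hU u).1 (hU u).2)) hd
    simpa [S] using this
  have hinj : Function.Injective (fun u : U => (⟨_, hmaps u⟩ : S)) := by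
    intro u u' huu
    have h3 := σ.injective.image_injective (congrArg Subtype.val huu)
    exact Subtype.ext
      (separating_left_injective hk hkn (hU u).1 (hU u').2 h3)
  have hle := Fintype.card_le_of_injective _ hinj
  rw [Fintype.card_coe] at hle
  have hS : S.card ≤ 3 := Finset.card_le_three
  have hUc : Fintype.card U = (n - 1) * 2 := by
    let e : U ≃ {i : Fin n // i ≠ r.1} × Bool :=
      { toFun := fun u => (⟨u.1.1, u.2⟩, u.1.2)
        invFun := fun p => ⟨(p.1.1, p.2), p.1.2⟩
        left_inv := fun _ => rfl
        right_inv := fun _ => rfl }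
    rw [Fintype.card_congr e, Fintype.card_prod, Fintype.card_bool, Fintype.card_subtype_compl]
    simp
  omega

/-! ### Facets -/

/-- A facet contains exactly one of any two antipodal vertices, so `separating k a b` consists of
the facets through `a` and `antip b`. -/
lemma mem_separating_of_facet (hkn : k + 1 = n) {a b : Fin n × Bool} {A : Face n k} :
    A ∈ separating k a b ↔ a ∈ A.1 ∧ antip b ∈ A.1 := by
  have h1 := A.mem_or_of_card hkn a
  have h2 := A.mem_or_of_card hkn b
  have h3 := A.2.2 a
  have h4 := A.2.2 b
  rw [mem_separating]
  tauto

lemma isMinGenerating_separating (hk : 1 ≤ k) (hkn : k + 1 = n) {a b : Fin n × Bool} (h1 : b ≠ a)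
    (h2 : b ≠ antip a) : IsMinGenerating (separating k a b) := by
  have key : ∀ u v : Fin n × Bool, v ≠ u → v ≠ antip u → separating k u v ⊆ separating k a b →
      a = u ∨ a = antip v := by
    intro u v h3 h4 hsub
    by_contra! hne
    obtain ⟨A, hA1, hA2, hA3, -⟩ := Face.exists_mem_not_mem (k := k) (x := u) (y := antip v)
      (z := a) (w := a) (fun h => h3 (antip_inj.1 h)) hne.1 hne.2 hne.1 hne.2
      (pair_card_le hk _ _) (Or.inr ⟨by omega, ne_antip _⟩)
    exact hA3 ((mem_separating_of_facet hkn).1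
      (hsub ((mem_separating_of_facet hkn).2 ⟨hA1, hA2⟩))).1
  have key' : ∀ u v : Fin n × Bool, v ≠ u → v ≠ antip u → separating k u v ⊆ separating k a b →
      antip b = u ∨ antip b = antip v := by
    intro u v h3 h4 hsub
    by_contra! hne
    obtain ⟨A, hA1, hA2, hA3, -⟩ := Face.exists_mem_not_mem (k := k) (x := u) (y := antip v)
      (z := antip b) (w := antip b) (fun h => h3 (antip_inj.1 h)) hne.1 hne.2 hne.1 hne.2
      (pair_card_le hk _ _) (Or.inr ⟨by omega, ne_antip _⟩)
    exact hA3 ((mem_separating_of_facet hkn).1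
      (hsub ((mem_separating_of_facet hkn).2 ⟨hA1, hA2⟩))).2
  refine ⟨separating_isGenerating h1 h2, ?_⟩
  rintro Y (⟨r, rfl⟩ | ⟨u, v, h3, h4, rfl⟩) hsub
  · exfalso
    have hr : ∀ c : Fin n × Bool, (∀ A ∈ separating k a b, c ∈ A.1) → c = r := by
      intro c hc
      by_contra hne
      obtain ⟨A, hA1, -, hA3, -⟩ := Face.exists_mem_not_mem (k := k) (x := r) (y := r)
        (z := c) (w := c) (ne_antip r) hne hne hne hne
        (pair_card_le hk _ _) (Or.inr ⟨by omega, ne_antip _⟩)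
      exact hA3 (hc A (hsub hA1))
    have e1 := hr a fun A hA => ((mem_separating_of_facet hkn).1 hA).1
    have e2 := hr (antip b) fun A hA => ((mem_separating_of_facet hkn).1 hA).2
    exact h2 (antip_eq_comm.1 (e2.trans e1.symm)).symm
  · have e1 := key u v h3 h4 hsub
    have e2 := key' u v h3 h4 hsub
    have h5 : antip b ≠ a := fun h => h2 (antip_eq_comm.1 h).symm
    rcases e1 with rfl | rfl
    · rcases e2 with h | h
      · exact absurd h h5
      · rw [antip_inj.1 h]
    · rcases e2 with rfl | h
      · rw [← separating_antip, antip_antip]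
      · exact absurd h h5

/-- The star of `r` is the union of `separating k r s` and `separating k r (antip s)`. The image of
the first of these sets, its opposite and disjointness leave only two possibilities for the image of
the second one, and both give a star. -/
lemma image_star_of_eq (hk : 1 ≤ k) (hkn : k + 1 = n)
    (hσ : ∀ X, IsGenerating X → IsUnionOfGenerating (σ '' X))
    (hopp : ∀ A, σ A.opp = (σ A).opp) (r : Fin n × Bool) :
    ∃ r', σ '' star k r = star k r' := by
  have hother : ∀ t : Fin n × Bool, ∃ s : Fin n × Bool, s.1 ≠ t.1 := fun t => by
    have : Nontrivial (Fin n) := Fin.nontrivial_iff_two_le.2 (by omega)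
    obtain ⟨j, hj⟩ := exists_ne t.1
    exact ⟨(j, true), hj⟩
  have hminimage : ∀ a b : Fin n × Bool, b ≠ a → b ≠ antip a →
      ∃ u v, v ≠ u ∧ v ≠ antip u ∧ σ '' separating k a b = separating k u v := by
    intro a b h1 h2
    have hmin := (isMinGenerating_separating hk hkn h1 h2).image hk (by omega) hσ
    rcases hmin.1 with ⟨t, ht⟩ | h
    · exfalso
      obtain ⟨s, hs⟩ := hother t
      have h3 : s ≠ t := fun h => hs (by rw [h])
      have h4 : s ≠ antip t := fun h => hs (by rw [h]; rfl)
      have hsub : separating k t s ⊆ σ '' separating k a b := by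
        rw [ht]
        exact fun A hA => ((mem_separating_of_facet hkn).1 hA).1
      have := hmin.2 _ (separating_isGenerating h3 h4) hsub
      rw [ht] at this
      obtain ⟨A, hA, hA'⟩ := Face.exists_mem (k := k) (x := t) (y := s) h4
        (pair_card_le hk _ _) (by omega)
      have h5 : A ∈ separating k t s := this ▸ hA
      exact Face.antip_not_mem ((mem_separating_of_facet hkn).1 h5).2 hA'
    · exact h
  obtain ⟨s, hs⟩ := hother r
  have h1 : s ≠ r := fun h => hs (by rw [h])
  have h2 : s ≠ antip r := fun h => hs (by rw [h]; rfl)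
  have h1' : antip s ≠ r := fun h => hs (by rw [← h]; rfl)
  have h2' : antip s ≠ antip r := fun h => h1 (antip_inj.1 h)
  obtain ⟨a, b, h3, h4, hab⟩ := hminimage r s h1 h2
  obtain ⟨c, d, h5, h6, hcd⟩ := hminimage r (antip s) h1' h2'
  have hba : σ '' separating k s r = separating k b a := by
    have e : ∀ x y : Fin n × Bool, Face.opp '' separating k x y = separating k y x := by
      have : ∀ x y : Fin n × Bool, Face.opp '' separating k x y ⊆ separating k y x := by
        rintro x y _ ⟨A, hA, rfl⟩
        rw [mem_separating_of_facet hkn] at hA ⊢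
        simpa using hA.symm
      intro x y
      refine (this x y).antisymm fun A hA => ⟨A.opp, this y x ⟨A, hA, rfl⟩, A.opp_opp⟩
    rw [← e r s, ← e a b, ← hab, Set.image_image, Set.image_image]
    exact Set.image_congr' hopp
  have hd1 : Disjoint (separating k c d) (separating k a b) := by
    rw [← hcd, ← hab, Set.disjoint_image_iff σ.injective, Set.disjoint_left]
    intro A hA hA'
    rw [mem_separating_of_facet hkn] at hA hA'
    rw [antip_antip] at hA
    exact Face.antip_not_mem hA'.2 hA.2
  have hd2 : Disjoint (separating k c d) (separating k b a) := by
    rw [← hcd, ← hba, Set.disjoint_image_iff σ.injective, Set.disjoint_left]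
    intro A hA hA'
    rw [mem_separating_of_facet hkn] at hA hA'
    exact Face.antip_not_mem hA'.2 hA.1
  have hstar : ∀ x y : Fin n × Bool, star k x = separating k x y ∪ separating k x (antip y) := by
    intro x y
    ext A
    rw [Set.mem_union, mem_separating_of_facet hkn, mem_separating_of_facet hkn, antip_antip,
      mem_star]
    have := A.mem_or_of_card hkn y
    tauto
  have hout : ∀ x y : Fin n × Bool, y ≠ x → Disjoint (separating k c d) (separating k x y) →
      (c = antip x ∨ d = x) ∨ (c = y ∨ d = antip y) := by
    intro x y hxy hdis
    by_contra! hne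
    obtain ⟨⟨n1, n2⟩, n3, n4⟩ := hne
    obtain ⟨A, hA1, hA2, hA3, hA4⟩ := Face.exists_mem_not_mem (k := k) (x := c) (y := antip d)
      (z := antip x) (w := y) (fun h => h5 (antip_inj.1 h)) n1.symm
      (fun h => n2 (antip_inj.1 h).symm) n3.symm (fun h => n4 (antip_eq_comm.1 h.symm).symm)
      (pair_card_le hk _ _) (Or.inr ⟨by omega, by rwa [antip_antip]⟩)
    refine Set.disjoint_left.1 hdis ((mem_separating_of_facet hkn).2 ⟨hA1, hA2⟩)
      ((mem_separating_of_facet hkn).2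
        ⟨(A.mem_or_of_card hkn x).resolve_right hA3, (A.mem_or_of_card hkn y).resolve_left hA4⟩)
  rw [hstar r s, Set.image_union, hab, hcd]
  have e1 := hout a b h3 hd1
  have e2 := hout b a h3.symm hd2
  have h7 : a ≠ antip b := fun h => h4 (antip_eq_comm.1 h.symm).symm
  have h8 : a ≠ antip a := ne_antip a
  have h9 : b ≠ antip b := ne_antip b
  have h10 : antip a ≠ antip b := fun h => h3 (antip_inj.1 h).symm
  have h11 : antip d ≠ c := fun h => h6 (antip_eq_comm.1 h).symm
  have : (c = antip a ∧ d = b) ∨ (d = a ∧ c = antip b) ∨ (c = b ∧ d = antip a) ∨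
      (c = a ∧ d = antip b) := by grind
  rcases this with ⟨rfl, rfl⟩ | ⟨rfl, rfl⟩ | ⟨rfl, rfl⟩ | ⟨rfl, rfl⟩
  · refine ⟨antip d, ?_⟩
    rw [hstar (antip d) a, Set.union_comm, ← separating_antip a d,
      ← separating_antip (antip a) d, antip_antip, Set.union_comm]
  · refine ⟨antip b, ?_⟩
    rw [hstar (antip b) d, Set.union_comm, ← separating_antip d b]
  · refine ⟨a, ?_⟩
    rw [hstar a c, Set.union_comm, ← separating_antip c (antip a), antip_antip]
    exact Set.union_comm _ _
  · refine ⟨c, ?_⟩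
    rw [hstar c b]

/-! ### Permutations of faces that map stars to stars -/

/-- A permutation of the faces which preserves unions of generating sets and opposition comes from
a permutation of the vertices. -/
theorem exists_perm_vertices (hkn : k < n)
    (hσ : ∀ X, IsGenerating X → IsUnionOfGenerating (σ '' X))
    (hopp : ∀ A, σ A.opp = (σ A).opp) :
    ∃ τ : Fin n × Bool → Fin n × Bool, (∀ r, τ (antip r) = antip (τ r)) ∧
      Function.Injective τ ∧ ∀ A : Face n k, ∀ r, r ∈ A.1 ↔ τ r ∈ (σ A).1 := by
  have hstar : ∀ r, ∃ r', σ '' star k r = star k r' := by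
    intro r
    rcases Nat.eq_zero_or_pos k with rfl | hk
    · obtain ⟨A, hA, -⟩ := Face.exists_mem (k := 0) (ne_antip r) (by simp) hkn
      obtain ⟨r', hr'⟩ := (σ A).nonempty
      have huniq : ∀ (B C : Face n 0) (t), t ∈ B.1 → t ∈ C.1 → B = C := by
        intro B C t hB hC
        obtain ⟨b, hb⟩ := Finset.card_eq_one.1 B.2.1
        obtain ⟨c, hc⟩ := Finset.card_eq_one.1 C.2.1
        rw [hb, Finset.mem_singleton] at hB
        rw [hc, Finset.mem_singleton] at hC
        exact Subtype.ext (by rw [hb, hc, ← hB, ← hC])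
      refine ⟨r', ?_⟩
      ext B
      constructor
      · rintro ⟨C, hC, rfl⟩
        rw [huniq C A r hC hA]
        exact hr'
      · intro hB
        exact ⟨A, hA, (huniq _ _ r' hB hr').symm⟩
    · rcases Nat.lt_or_ge (k + 1) n with h | h
      · exact image_star_of_lt hk h hσ r
      · exact image_star_of_eq hk (by omega) hσ hopp r
  choose τ hτ using hstar
  have hmem : ∀ (A : Face n k) r, r ∈ A.1 ↔ τ r ∈ (σ A).1 := by
    intro A r
    have : σ A ∈ σ '' star k r ↔ σ A ∈ star k (τ r) := by rw [hτ]
    rw [σ.injective.mem_set_image] at this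
    exact this
  have hinj : Function.Injective τ := by
    intro r s hrs
    by_contra hne
    obtain ⟨A, hA1, -, hA2, -⟩ := Face.exists_mem_not_mem (k := k) (x := r) (y := r) (z := s)
      (w := s) (ne_antip r) (Ne.symm hne) (Ne.symm hne) (Ne.symm hne) (Ne.symm hne) (by simp)
      (Or.inr ⟨hkn, ne_antip _⟩)
    exact hA2 ((hmem A s).2 (hrs ▸ (hmem A r).1 hA1))
  refine ⟨τ, fun r => ?_, hinj, hmem⟩
  rcases Nat.eq_zero_or_pos k with rfl | hk
  · obtain ⟨A, hA, -⟩ := Face.exists_mem (k := 0) (ne_antip r) (by simp) hkn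
    have h1 : τ (antip r) ∈ (σ A.opp).1 := (hmem _ _).1 (by simpa using hA)
    rw [hopp, Face.mem_opp] at h1
    obtain ⟨b, hb⟩ := Finset.card_eq_one.1 (σ A).2.1
    have h2 := (hmem _ _).1 hA
    rw [hb, Finset.mem_singleton] at h1 h2
    rw [h2, ← h1, antip_antip]
  · by_contra hne
    obtain ⟨A, hA1, hA2⟩ := Face.exists_mem (k := k) hne (pair_card_le hk _ _) hkn
    have h1 := (hmem (σ.symm A) r).2 (by simpa using hA1)
    have h2 := (hmem (σ.symm A) (antip r)).2 (by simpa using hA2)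
    exact (σ.symm A).2.2 r h1 h2

end

/-! ### Frames -/

/-- A fixed-point-free involution of a set of `2 * n` elements is, up to a labelling, the antipodal
map of the cross-polytope. -/
lemma exists_labelling {α : Type*} [Fintype α] {n : ℕ} (hα : Fintype.card α = 2 * n) (τ : α → α)
    (hτ : ∀ x, τ (τ x) = x) (hne : ∀ x, τ x ≠ x) :
    ∃ e : Fin n × Bool ≃ α, ∀ r, e (antip r) = τ (e r) := by
  classical
  let g : α ≃ Fin (Fintype.card α) := Fintype.equivFin α
  let L := {x : α // g x < g (τ x)}
  let m : L × Bool → α := fun p => if p.2 then p.1.1 else τ p.1.1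
  have hbij : Function.Bijective m := by
    constructor
    · rintro ⟨⟨x, hx⟩, b⟩ ⟨⟨y, hy⟩, c⟩ h
      have hinj : ∀ x y, τ x = τ y → x = y := fun x y h => by rw [← hτ x, h, hτ]
      cases b <;> cases c <;> simp only [m, if_true, Bool.false_eq_true, if_false] at h
      · have := hinj _ _ h
        subst this; rfl
      · subst h; rw [hτ] at hy; exact absurd hx (not_lt.2 hy.le)
      · subst h; rw [hτ] at hx; exact absurd hx (not_lt.2 hy.le)
      · subst h; rfl
    · intro x
      rcases lt_or_ge (g x) (g (τ x)) with h | h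
      · exact ⟨(⟨x, h⟩, true), rfl⟩
      · refine ⟨(⟨τ x, ?_⟩, false), hτ x⟩
        rw [hτ]
        exact lt_of_le_of_ne h (fun h' => hne x (g.injective h'))
  have hL : Fintype.card L = n := by
    have := Fintype.card_of_bijective hbij
    rw [Fintype.card_prod, Fintype.card_bool] at this
    omega
  let eL : Fin n ≃ L := (Fintype.equivFinOfCardEq hL).symm
  refine ⟨(eL.prodCongr (Equiv.refl Bool)).trans (Equiv.ofBijective m hbij), ?_⟩
  rintro ⟨i, b⟩
  cases b <;> simp [m, antip, hτ]

section Frames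

variable {F V : Type*} [Field F] [AddCommGroup V] [Module F V]
  {n k : ℕ} {Ω : LinearMap.BilinForm F V} {v w : Fin n × Bool → V}

lemma pointOrthogonal_mk {x y : V} (hx : x ≠ 0) (hy : y ≠ 0) :
    PointOrthogonal Ω (Projectivization.mk F x hx) (Projectivization.mk F y hy) ↔ Ω x y = 0 := by
  unfold PointOrthogonal
  rw [Projectivization.submodule_mk, Projectivization.submodule_mk]
  constructor
  · exact fun h => h x (Submodule.mem_span_singleton_self x) y
      (Submodule.mem_span_singleton_self y)
  · intro h a ha b hb
    obtain ⟨c, rfl⟩ := Submodule.mem_span_singleton.1 ha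
    obtain ⟨d, rfl⟩ := Submodule.mem_span_singleton.1 hb
    rw [map_smul, map_smul, LinearMap.smul_apply, h, smul_zero, smul_zero]

lemma pointOrthogonal_iff_rep (p q : ℙ F V) : PointOrthogonal Ω p q ↔ Ω p.rep q.rep = 0 := by
  rw [← pointOrthogonal_mk (Ω := Ω) p.rep_nonzero q.rep_nonzero, p.mk_rep, q.mk_rep]

lemma isTotallyIsotropic_iff {S : Submodule F V} :
    IsTotallyIsotropic Ω S ↔ ∀ x ∈ S, ∀ y ∈ S, Ω x y = 0 := by
  constructor
  · intro h x hx y hy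
    by_cases hx0 : x = 0
    · rw [hx0, map_zero, LinearMap.zero_apply]
    by_cases hy0 : y = 0
    · rw [hy0, map_zero]
    have hmem : ∀ z (hz : z ≠ 0), z ∈ S → Projectivization.mk F z hz ∈ pointsOf S := by
      intro z hz hzS
      rw [pointsOf, Set.mem_ofPred_eq, Projectivization.submodule_mk]
      exact (Submodule.span_singleton_le_iff_mem _ _).2 hzS
    exact (pointOrthogonal_mk hx0 hy0).1 (h _ (hmem x hx0 hx) _ (hmem y hy0 hy))
  · intro h p hp q hq x hx y hy
    exact h x (hp hx) y (hq hy)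

lemma apply_ne_zero_comm (hΩ : Ω.IsAlt) (x y : V) : Ω x y ≠ 0 ↔ Ω y x ≠ 0 := by
  rw [← hΩ.neg_eq y x, neg_ne_zero]

/-- A spanning family of vectors indexed by the vertices of the cross-polytope in which precisely
the antipodal vectors are non-orthogonal: the labelled form of a symplectic base. The values of the
form are not normalized. -/
structure IsFrame (Ω : LinearMap.BilinForm F V) (v : Fin n × Bool → V) : Prop where
  apply_ne_zero_iff : ∀ r s, Ω (v r) (v s) ≠ 0 ↔ s = antip r
  span_range : Submodule.span F (Set.range v) = ⊤

/-- The subspace spanned by the vectors of a frame at a set of vertices. -/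
def frameSpan (F : Type*) {V : Type*} [Field F] [AddCommGroup V] [Module F V]
    (v : Fin n × Bool → V) (P : Set (Fin n × Bool)) : Submodule F V :=
  Submodule.span F (v '' P)

lemma subset_frameSpan {P : Set (Fin n × Bool)} {r : Fin n × Bool} (h : r ∈ P) :
    v r ∈ frameSpan F v P :=
  Submodule.subset_span ⟨r, h, rfl⟩

lemma frameSpan_le {P : Set (Fin n × Bool)} {S : Submodule F V} :
    frameSpan F v P ≤ S ↔ ∀ r ∈ P, v r ∈ S := by
  rw [frameSpan, Submodule.span_le, Set.image_subset_iff]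
  rfl

/-- A sum over vectors with the orthogonality relations of a frame is paired with one of these
vectors. -/
lemma sum_apply_antip (hv : ∀ r s, Ω (v r) (v s) ≠ 0 ↔ s = antip r) (c : Fin n × Bool → F)
    (s : Fin n × Bool) : Ω (∑ r, c r • v r) (v (antip s)) = c s * Ω (v s) (v (antip s)) := by
  rw [map_sum, LinearMap.sum_apply, Finset.sum_eq_single s]
  · rw [map_smul, LinearMap.smul_apply, smul_eq_mul]
  · intro r _ hr
    rw [map_smul, LinearMap.smul_apply, not_not.1 (mt (hv r (antip s)).1
      (fun h => hr (antip_inj.1 h).symm)), smul_zero]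
  · simp

lemma linearIndependent_of_apply (hv : ∀ r s, Ω (v r) (v s) ≠ 0 ↔ s = antip r) :
    LinearIndependent F v := by
  rw [Fintype.linearIndependent_iff]
  intro c hc s
  have h := sum_apply_antip hv c s
  rw [hc, map_zero, LinearMap.zero_apply] at h
  exact (mul_eq_zero.1 h.symm).resolve_right ((hv s _).2 rfl)

lemma card_vertices (n : ℕ) : Fintype.card (Fin n × Bool) = 2 * n := by
  rw [Fintype.card_prod, Fintype.card_fin, Fintype.card_bool, mul_comm]

lemma isFrame_of_apply (hn : 0 < n) (hV : Module.finrank F V = 2 * n)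
    (hv : ∀ r s, Ω (v r) (v s) ≠ 0 ↔ s = antip r) : IsFrame Ω v := by
  have : Nonempty (Fin n × Bool) := ⟨(⟨0, hn⟩, true)⟩
  exact ⟨hv, (linearIndependent_of_apply hv).span_eq_top_of_card_eq_finrank
    (by rw [card_vertices, hV])⟩

namespace IsFrame

lemma apply_antip (hv : IsFrame Ω v) (r : Fin n × Bool) : Ω (v r) (v (antip r)) ≠ 0 :=
  (hv.1 r _).2 rfl

lemma apply_eq_zero (hv : IsFrame Ω v) {r s : Fin n × Bool} (h : s ≠ antip r) :
    Ω (v r) (v s) = 0 :=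
  not_not.1 (fun h' => h ((hv.1 r s).1 h'))

lemma ne_zero (hv : IsFrame Ω v) (r : Fin n × Bool) : v r ≠ 0 := by
  intro h
  apply hv.apply_antip r
  rw [h, map_zero, LinearMap.zero_apply]

lemma linearIndependent (hv : IsFrame Ω v) : LinearIndependent F v :=
  linearIndependent_of_apply hv.1

lemma injective (hv : IsFrame Ω v) : Function.Injective v := hv.linearIndependent.injective

/-- Membership in the span of a part of a frame is a system of orthogonality relations. -/
lemma mem_frameSpan (hv : IsFrame Ω v) {P : Set (Fin n × Bool)} {x : V} :
    x ∈ frameSpan F v P ↔ ∀ s ∉ P, Ω x (v (antip s)) = 0 := by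
  constructor
  · intro hx s hs
    refine Submodule.span_induction (p := fun x _ => Ω x (v (antip s)) = 0) ?_ ?_ ?_ ?_ hx
    · rintro _ ⟨r, hr, rfl⟩
      exact hv.apply_eq_zero (fun h => hs (antip_inj.1 h ▸ hr))
    · simp
    · intro x y _ _ hx hy
      rw [map_add, LinearMap.add_apply, hx, hy, add_zero]
    · intro a x _ hx
      rw [map_smul, LinearMap.smul_apply, hx, smul_zero]
  · intro h
    obtain ⟨c, rfl⟩ := (Submodule.mem_span_range_iff_exists_fun F).1
      (show x ∈ Submodule.span F (Set.range v) by rw [hv.span_range]; trivial)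
    refine Submodule.sum_mem _ fun r _ => ?_
    by_cases hr : r ∈ P
    · exact Submodule.smul_mem _ _ (subset_frameSpan hr)
    · have h1 := h r hr
      rw [sum_apply_antip hv.1] at h1
      rw [(mul_eq_zero.1 h1).resolve_right (hv.apply_antip r), zero_smul]
      exact Submodule.zero_mem _

lemma mem_frameSpan_iff (hv : IsFrame Ω v) {P : Set (Fin n × Bool)} {r : Fin n × Bool} :
    v r ∈ frameSpan F v P ↔ r ∈ P := by
  refine ⟨fun h => ?_, subset_frameSpan⟩
  by_contra hr
  exact hv.apply_antip r (hv.mem_frameSpan.1 h r hr)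

lemma frameSpan_injective (hv : IsFrame Ω v) {P Q : Set (Fin n × Bool)}
    (h : frameSpan F v P = frameSpan F v Q) : P = Q := by
  ext r
  rw [← hv.mem_frameSpan_iff, h, hv.mem_frameSpan_iff]

lemma frameSpan_iInter (hv : IsFrame Ω v) {ι : Sort*} (P : ι → Set (Fin n × Bool)) :
    frameSpan F v (⋂ i, P i) = ⨅ i, frameSpan F v (P i) := by
  ext x
  rw [Submodule.mem_iInf, hv.mem_frameSpan]
  simp_rw [hv.mem_frameSpan, Set.mem_iInter, not_forall]
  exact ⟨fun h i s hs => h s ⟨i, hs⟩, fun h s ⟨i, hs⟩ => h i s hs⟩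

lemma frameSpan_inter (hv : IsFrame Ω v) (P Q : Set (Fin n × Bool)) :
    frameSpan F v (P ∩ Q) = frameSpan F v P ⊓ frameSpan F v Q := by
  ext x
  rw [Submodule.mem_inf, hv.mem_frameSpan, hv.mem_frameSpan, hv.mem_frameSpan]
  simp_rw [Set.mem_inter_iff]
  exact ⟨fun h => ⟨fun s hs => h s (fun h' => hs h'.1), fun s hs => h s (fun h' => hs h'.2)⟩,
    fun h s hs => by
      by_cases h' : s ∈ P
      · exact h.2 s (fun h2 => hs ⟨h', h2⟩)
      · exact h.1 s h'⟩

/-- The orthogonal complement of the span of a part `P` of a frame is the span of the vectors at the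
vertices whose antipodes are not in `P`. -/
lemma mem_frameSpan_orthogonal (hv : IsFrame Ω v) {P : Set (Fin n × Bool)} {x : V} :
    x ∈ frameSpan F v {s | antip s ∉ P} ↔ ∀ y ∈ frameSpan F v P, Ω x y = 0 := by
  rw [hv.mem_frameSpan]
  constructor
  · intro h y hy
    refine Submodule.span_induction (p := fun y _ => Ω x y = 0) ?_ ?_ ?_ ?_ hy
    · rintro _ ⟨r, hr, rfl⟩
      have := h (antip r) (by simpa using hr)
      rwa [antip_antip] at this
    · simp
    · intro y z _ _ hy hz
      rw [map_add, hy, hz, add_zero]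
    · intro a y _ hy
      rw [map_smul, hy, smul_zero]
  · intro h s hs
    exact h _ (subset_frameSpan (by simpa using hs))

lemma finrank_frameSpan (hv : IsFrame Ω v) (A : Finset (Fin n × Bool)) :
    Module.finrank F (frameSpan F v A) = A.card := by
  classical
  have h := finrank_span_set_eq_card (R := F) (s := v '' (A : Set (Fin n × Bool)))
    (hv.linearIndependent.linearIndepOn_id.mono (Set.image_subset_range _ _))
  rw [frameSpan, h, Set.toFinset_image, Finset.toFinset_coe,
    Finset.card_image_of_injective _ hv.injective]

lemma isTotallyIsotropic_frameSpan (hv : IsFrame Ω v) {P : Set (Fin n × Bool)} :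
    IsTotallyIsotropic Ω (frameSpan F v P) ↔ ∀ r ∈ P, antip r ∉ P := by
  rw [isTotallyIsotropic_iff]
  constructor
  · intro h r hr hr'
    exact hv.apply_antip r (h _ (subset_frameSpan hr) _ (subset_frameSpan hr'))
  · intro h x hx
    rw [← hv.mem_frameSpan_orthogonal]
    exact Submodule.span_mono (Set.image_mono h) hx

/-- The element of the Grassmannian spanned by the vectors of a frame at a face. -/
def face (hv : IsFrame Ω v) (A : Face n k) : Grassmannian Ω k :=
  ⟨frameSpan F v A.1, by rw [hv.finrank_frameSpan, A.2.1],
    hv.isTotallyIsotropic_frameSpan.2 A.2.2⟩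

lemma face_val (hv : IsFrame Ω v) (A : Face n k) : (hv.face A).1 = frameSpan F v A.1 := rfl

lemma face_injective (hv : IsFrame Ω v) : Function.Injective (hv.face (k := k)) := by
  intro A B h
  have := hv.frameSpan_injective (congrArg Subtype.val h)
  exact Subtype.ext (Finset.coe_injective this)

lemma exists_face (hv : IsFrame Ω v) {S : Grassmannian Ω k} {P : Set (Fin n × Bool)}
    (h : S.1 = frameSpan F v P) :
    ∃ A : Face n k, (A.1 : Set (Fin n × Bool)) = P ∧ hv.face A = S := by
  classical
  obtain ⟨A, rfl⟩ : ∃ A : Finset (Fin n × Bool), (A : Set (Fin n × Bool)) = P :=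
    ⟨P.toFinset, by simp⟩
  have h1 := S.2.1
  have h2 := S.2.2
  rw [h, hv.finrank_frameSpan] at h1
  rw [h, hv.isTotallyIsotropic_frameSpan] at h2
  exact ⟨⟨A, h1, h2⟩, rfl, Subtype.ext h.symm⟩

/-- The point spanned by a vector of a frame. -/
def point (hv : IsFrame Ω v) (r : Fin n × Bool) : ℙ F V :=
  Projectivization.mk F (v r) (hv.ne_zero r)

lemma submodule_point (hv : IsFrame Ω v) (r : Fin n × Bool) :
    (hv.point r).submodule = Submodule.span F {v r} := Projectivization.submodule_mk _ _

lemma pointOrthogonal_point (hv : IsFrame Ω v) (r s : Fin n × Bool) :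
    ¬ PointOrthogonal Ω (hv.point r) (hv.point s) ↔ s = antip r := by
  rw [point, point, pointOrthogonal_mk, ← hv.1 r s]

lemma point_injective (hv : IsFrame Ω v) : Function.Injective hv.point := by
  intro r s h
  have h1 := hv.pointOrthogonal_point r (antip r)
  rw [h, hv.pointOrthogonal_point, antip_inj] at h1
  exact h1.2 rfl

lemma pointSpan_image (hv : IsFrame Ω v) (P : Set (Fin n × Bool)) :
    pointSpan (hv.point '' P) = frameSpan F v P := by
  apply le_antisymm
  · refine iSup₂_le ?_
    rintro _ ⟨r, hr, rfl⟩
    rw [submodule_point, Submodule.span_singleton_le_iff_mem]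
    exact subset_frameSpan hr
  · rw [frameSpan_le]
    intro r hr
    have h : (hv.point r).submodule ≤ pointSpan (hv.point '' P) :=
      le_iSup₂_of_le (hv.point r) ⟨r, hr, rfl⟩ le_rfl
    rw [submodule_point, Submodule.span_singleton_le_iff_mem] at h
    exact h

lemma isSymplecticBase (hv : IsFrame Ω v) : IsSymplecticBase Ω (Set.range hv.point) := by
  refine ⟨⟨?_, ?_⟩, ?_⟩
  · rw [Projectivization.independent_iff,
      ← linearIndependent_equiv (Equiv.ofInjective _ hv.point_injective)]
    refine linearIndependent_of_apply (Ω := Ω) fun r s => ?_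
    rw [← hv.pointOrthogonal_point r s, pointOrthogonal_iff_rep]
    rfl
  · rw [← Set.image_univ, hv.pointSpan_image, frameSpan, Set.image_univ, hv.span_range]
  · rintro _ ⟨r, rfl⟩
    refine ⟨hv.point (antip r), ⟨⟨_, rfl⟩, (hv.pointOrthogonal_point _ _).2 rfl⟩, ?_⟩
    rintro _ ⟨⟨s, rfl⟩, hs⟩
    rw [(hv.pointOrthogonal_point _ _).1 hs]

lemma baseSubset_range (hv : IsFrame Ω v) :
    baseSubset Ω k (Set.range hv.point) = Set.range (hv.face (k := k)) := by
  ext S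
  constructor
  · rintro ⟨A, hA, hS⟩
    obtain ⟨P, rfl⟩ := Set.subset_range_iff_exists_image_eq.1 hA
    rw [hv.pointSpan_image] at hS
    obtain ⟨B, -, hB⟩ := hv.exists_face hS
    exact ⟨B, hB⟩
  · rintro ⟨A, rfl⟩
    exact ⟨hv.point '' A.1, Set.image_subset_range _ _, (hv.pointSpan_image _).symm⟩

lemma isBaseSubset (hv : IsFrame Ω v) : IsBaseSubset Ω k (Set.range (hv.face (k := k))) :=
  ⟨_, hv.isSymplecticBase, hv.baseSubset_range.symm⟩

end IsFrame

/-- Every symplectic base comes from a frame. -/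
lemma IsSymplecticBase.exists_frame (hn : 0 < n) (hV : Module.finrank F V = 2 * n)
    (hΩ : Ω.IsAlt) {B : Set (ℙ F V)} (hB : IsSymplecticBase Ω B) :
    ∃ (v : Fin n × Bool → V) (hv : IsFrame Ω v), B = Set.range hv.point := by
  obtain ⟨⟨hind, hspan⟩, huniq⟩ := hB
  rw [Projectivization.independent_iff] at hind
  have hfin : Module.Finite F V := Module.finite_of_finrank_pos (by omega)
  have hBfin : Finite B := hind.finite
  have hBF : Fintype B := Fintype.ofFinite B
  have htop :
      ⊤ ≤ Submodule.span F (Set.range (Projectivization.rep ∘ fun p : B => (p : ℙ F V))) := by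
    rw [← hspan]
    refine iSup₂_le fun p hp => ?_
    rw [p.submodule_eq, Submodule.span_singleton_le_iff_mem]
    exact Submodule.subset_span ⟨⟨p, hp⟩, rfl⟩
  have hcard : Fintype.card B = 2 * n := by
    rw [← hV, Module.finrank_eq_card_basis (Module.Basis.mk hind htop)]
  have huniq' : ∀ p : B, ∃ q : B, ¬ PointOrthogonal Ω p.1 q.1 ∧
      ∀ q' : B, ¬ PointOrthogonal Ω p.1 q'.1 → q' = q := by
    intro p
    obtain ⟨q, hq1, hq2⟩ := huniq p.1 p.2
    exact ⟨⟨q, hq1.1⟩, hq1.2, fun q' hq' => Subtype.ext (hq2 _ ⟨q'.2, hq'⟩)⟩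
  choose τ hτ1 hτ2 using huniq'
  have hsymm : ∀ p q : ℙ F V, ¬ PointOrthogonal Ω p q → ¬ PointOrthogonal Ω q p := by
    intro p q h
    rw [pointOrthogonal_iff_rep] at h ⊢
    exact (apply_ne_zero_comm hΩ _ _).1 h
  obtain ⟨e, he⟩ := exists_labelling hcard τ
    (fun p => (hτ2 _ _ (hsymm _ _ (hτ1 p))).symm)
    (fun p h => hτ1 p (by rw [h, pointOrthogonal_iff_rep]; exact hΩ _))
  have hv : IsFrame Ω (fun r => (e r).1.rep) := by
    refine isFrame_of_apply hn hV fun r s => ?_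
    rw [← not_iff_not, not_not, ← pointOrthogonal_iff_rep, ← not_iff_not, not_not]
    constructor
    · intro h
      apply e.injective
      rw [he]
      exact hτ2 _ _ h
    · rintro rfl
      rw [he]
      exact hτ1 _
  refine ⟨_, hv, ?_⟩
  have hp : ∀ r, hv.point r = (e r).1 := fun r => (e r).1.mk_rep
  ext p
  constructor
  · intro hpB
    exact ⟨e.symm ⟨p, hpB⟩, by rw [hp, e.apply_symm_apply]⟩
  · rintro ⟨r, rfl⟩
    rw [hp]
    exact (e r).2

end Frames

/-! ### Intersections of base subsets -/

section Intersections

variable {F V : Type*} [Field F] [AddCommGroup V] [Module F V]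
  {n k : ℕ} {Ω : LinearMap.BilinForm F V} {v w : Fin n × Bool → V}

/-- The faces of one frame that are not spanned by vectors of another frame form a union of
generating sets. The subspaces spanned by parts of both frames are closed under sums, intersections
and orthogonal complements; so if `A` is not one of them, there are `r ∈ A` and `s ∉ A` such that
every such subspace through the vector at `r` contains the vector at `s`, and passing to orthogonal
complements shows the same for `antip s` and `antip r`. -/
lemma IsFrame.isUnionOfGenerating_notMem_range (hv : IsFrame Ω v) (hw : IsFrame Ω w) :
    IsUnionOfGenerating {A : Face n k | hv.face A ∉ Set.range (hw.face (k := k))} := by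
  intro A hA
  let C : Set (Fin n × Bool) → Prop := fun P => ∃ Q, frameSpan F v P = frameSpan F w Q
  have hC : ∀ B : Face n k, hv.face B ∉ Set.range (hw.face (k := k)) ↔ ¬ C B.1 := by
    intro B
    rw [not_iff_not]
    constructor
    · rintro ⟨D, hD⟩
      exact ⟨D.1, (congrArg Subtype.val hD).symm⟩
    · rintro ⟨Q, hQ⟩
      obtain ⟨D, -, hD⟩ := hw.exists_face (S := hv.face B) hQ
      exact ⟨D, hD⟩
  have hCperp : ∀ P, C P → C {s | antip s ∉ P} := by
    rintro P ⟨Q, hQ⟩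
    refine ⟨{s | antip s ∉ Q}, ?_⟩
    ext x
    rw [hv.mem_frameSpan_orthogonal, hw.mem_frameSpan_orthogonal, hQ]
  obtain ⟨r, hr, s, hs, hrs⟩ : ∃ r ∈ A.1, ∃ s, s ∉ A.1 ∧ ∀ P, C P → r ∈ P → s ∈ P := by
    by_contra! hne
    refine (hC A).1 hA ?_
    choose P hP1 hP2 hP3 using hne
    choose Q hQ using hP1
    refine ⟨⋃ r : A.1, ⋂ s : {s // s ∉ A.1}, Q r.1 r.2 s.1 s.2, ?_⟩
    have hAP : (A.1 : Set (Fin n × Bool)) =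
        ⋃ r : A.1, ⋂ s : {s // s ∉ A.1}, P r.1 r.2 s.1 s.2 := by
      ext t
      rw [Set.mem_iUnion]
      simp_rw [Set.mem_iInter]
      constructor
      · exact fun ht => ⟨⟨t, ht⟩, fun s => hP2 _ _ _ _⟩
      · rintro ⟨r, hr⟩
        by_contra ht
        exact hP3 r.1 r.2 t ht (hr ⟨t, ht⟩)
    rw [hAP, frameSpan, frameSpan, Set.image_iUnion, Set.image_iUnion, Submodule.span_iUnion,
      Submodule.span_iUnion]
    refine iSup_congr fun r => ?_
    change frameSpan F v _ = frameSpan F w _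
    rw [hv.frameSpan_iInter, hw.frameSpan_iInter]
    exact iInf_congr fun s => hQ _ _ _ _
  have hout : ∀ B : Face n k, r ∈ B.1 → s ∉ B.1 →
      B ∈ {A : Face n k | hv.face A ∉ Set.range (hw.face (k := k))} :=
    fun B h1 h2 => (hC B).2 fun h => h2 (hrs _ h h1)
  have hsr : s ≠ r := fun h => hs (h ▸ hr)
  by_cases hsr' : s = antip r
  · exact ⟨star k r, star_isGenerating r, hr, fun B hB => hout B hB (hsr' ▸ B.2.2 r hB)⟩
  · refine ⟨separating k r s, separating_isGenerating hsr hsr', Or.inl ⟨hr, hs⟩, ?_⟩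
    rintro B (⟨h1, h2⟩ | ⟨h1, h2⟩)
    · exact hout B h1 h2
    · refine (hC B).2 fun h => ?_
      exact hrs _ (hCperp _ h) h2 h1

end Intersections

/-! ### Triples of frames -/

section Triples

variable {F V : Type*} [Field F] [AddCommGroup V] [Module F V]
  {n k : ℕ} {Ω : LinearMap.BilinForm F V} {v w v₀ v₁ v₂ : Fin n × Bool → V}

/-- Three frames whose base subsets consist of a common part together with two of three further
parts: the base subset of `v₀` is the disjoint union of the common part and the parts given by `X₁`
and `X₂`, and the part of `X₁`, respectively `X₂`, is replaced by one and the same third part in the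
base subset of `v₁`, respectively `v₂`. -/
structure IsTriple (h₀ : IsFrame Ω v₀) (h₁ : IsFrame Ω v₁) (h₂ : IsFrame Ω v₂)
    (X₁ X₂ : Set (Face n k)) : Prop where
  disjoint : Disjoint X₁ X₂
  face_eq₁ : ∀ A ∉ X₁, h₀.face A = h₁.face A
  face_eq₂ : ∀ A ∉ X₂, h₀.face A = h₂.face A
  exists_face_eq : ∀ A ∈ X₁, ∃ C ∈ X₂, h₁.face A = h₂.face C

/-- The image of a face under a map of vertices which commutes with the antipodal map. -/
def Face.map (τ : Fin n × Bool → Fin n × Bool) (hτ : ∀ r, τ (antip r) = antip (τ r))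
    (hinj : Function.Injective τ) (A : Face n k) : Face n k :=
  ⟨A.1.image τ, by rw [Finset.card_image_of_injective _ hinj, A.2.1], by
    intro r hr h
    obtain ⟨s, hs, rfl⟩ := Finset.mem_image.1 hr
    rw [← hτ, hinj.mem_finset_image] at h
    exact A.2.2 s hs h⟩

lemma Face.mem_map {τ : Fin n × Bool → Fin n × Bool} (hτ : ∀ r, τ (antip r) = antip (τ r))
    (hinj : Function.Injective τ) {A : Face n k} {r : Fin n × Bool} :
    τ r ∈ (A.map τ hτ hinj).1 ↔ r ∈ A.1 :=
  hinj.mem_finset_image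

lemma IsFrame.face_map (hv : IsFrame Ω v) (hw : IsFrame Ω w) {τ : Fin n × Bool → Fin n × Bool}
    (hτ : ∀ r, τ (antip r) = antip (τ r)) (hinj : Function.Injective τ) {A : Face n k}
    (h : ∀ r ∈ A.1, w (τ r) = v r) : hv.face A = hw.face (A.map τ hτ hinj) := by
  apply Subtype.ext
  rw [face_val, face_val, frameSpan, frameSpan, Face.map, Finset.coe_image, ← Set.image_comp]
  congr 1
  exact Set.image_congr fun r hr => (h r hr).symm

/-- The frame obtained by replacing one of two antipodal vectors by their sum. -/
lemma IsFrame.update_add_antip (hΩ : Ω.IsAlt) (hn : 0 < n) (hV : Module.finrank F V = 2 * n)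
    (hv : IsFrame Ω v) (r : Fin n × Bool) :
    IsFrame Ω (Function.update v r (v r + v (antip r))) := by
  refine isFrame_of_apply hn hV fun t u => ?_
  have key : ∀ u, u ≠ r → (Ω (v r + v (antip r)) (v u) ≠ 0 ↔ u = antip r) := by
    intro u hu
    rw [map_add, LinearMap.add_apply, hv.apply_eq_zero (r := antip r) (by rwa [antip_antip]),
      add_zero, hv.1]
  by_cases ht : t = r
  · subst ht
    rw [Function.update_self]
    by_cases hu : u = t
    · subst hu
      rw [Function.update_self, hΩ]
      simp [ne_antip]
    · rw [Function.update_of_ne hu, key u hu]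
  · rw [Function.update_of_ne ht]
    by_cases hu : u = r
    · subst hu
      rw [Function.update_self, apply_ne_zero_comm hΩ, key t ht, eq_comm, antip_eq_comm, eq_comm]
    · rw [Function.update_of_ne hu, hv.1]

/-- A pair of antipodal vertices gives a triple of frames. -/
lemma IsFrame.exists_triple_star (hΩ : Ω.IsAlt) (hn : 0 < n) (hV : Module.finrank F V = 2 * n)
    (hv : IsFrame Ω v) (r : Fin n × Bool) : ∃ (v₁ v₂ : Fin n × Bool → V) (h₁ : IsFrame Ω v₁)
      (h₂ : IsFrame Ω v₂), IsTriple hv h₁ h₂ (star k r) (star k (antip r)) := by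
  have h₁ := hv.update_add_antip hΩ hn hV r
  have h₂ := hv.update_add_antip hΩ hn hV (antip r)
  have hface : ∀ (t : Fin n × Bool) (x : V) (h : IsFrame Ω (Function.update v t x)),
      ∀ A ∉ star k t, hv.face A = h.face A := by
    intro t x h A hA
    apply Subtype.ext
    rw [face_val, face_val, frameSpan, frameSpan]
    congr 1
    refine Set.image_congr fun s hs => ?_
    rw [Function.update_of_ne]
    rintro rfl
    exact hA hs
  let π : Equiv.Perm (Fin n × Bool) := Equiv.swap r (antip r)
  have hπ1 : π r = antip r := Equiv.swap_apply_left _ _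
  have hπ2 : π (antip r) = r := Equiv.swap_apply_right _ _
  have hπ3 : ∀ t, t ≠ r → t ≠ antip r → π t = t := fun t => Equiv.swap_apply_of_ne_of_ne
  have hπ : ∀ t, π (antip t) = antip (π t) := by
    intro t
    by_cases h1 : t = r
    · rw [h1, hπ1, hπ2, antip_antip]
    by_cases h2 : t = antip r
    · rw [h2, antip_antip, hπ1, hπ2]
    rw [hπ3 t h1 h2, hπ3 _ (fun h => h2 (antip_eq_comm.1 h).symm) (fun h => h1 (antip_inj.1 h))]
  refine ⟨_, _, h₁, h₂, ?_, hface _ _ h₁, hface _ _ h₂, ?_⟩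
  · rw [Set.disjoint_left]
    exact fun A hA hA' => A.2.2 r hA hA'
  · intro A hA
    refine ⟨A.map π hπ π.injective, ?_, h₁.face_map h₂ hπ π.injective ?_⟩
    · rw [mem_star, ← hπ1]
      exact (Face.mem_map hπ π.injective).2 hA
    · intro t ht
      by_cases h1 : t = r
      · rw [h1, hπ1, Function.update_self, Function.update_self, antip_antip, add_comm]
      · have h2 : t ≠ antip r := fun h => A.2.2 r hA (h ▸ ht)
        rw [hπ3 t h1 h2, Function.update_of_ne h1, Function.update_of_ne h2]

/-- Replacement of the values at `r` and `s` by `x` and `y`. -/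
def replace {X : Type*} (v : Fin n × Bool → X) (r s : Fin n × Bool) (x y : X) : Fin n × Bool → X :=
  Function.update (Function.update v s y) r x

lemma replace_left {X : Type*} {v : Fin n × Bool → X} (r s : Fin n × Bool) (x y : X) :
    replace v r s x y r = x :=
  Function.update_self _ _ _

lemma replace_right {X : Type*} {v : Fin n × Bool → X} {r s : Fin n × Bool} (h : s ≠ r) (x y : X) :
    replace v r s x y s = y := by
  rw [replace, Function.update_of_ne h, Function.update_self]

lemma replace_of_ne {X : Type*} {v : Fin n × Bool → X} {r s t : Fin n × Bool} (h : t ≠ r)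
    (h' : t ≠ s) (x y : X) :
    replace v r s x y t = v t := by
  rw [replace, Function.update_of_ne h, Function.update_of_ne h']

/-- The vectors of a frame at `r` and `antip s` can be modified by multiples of the vectors at `s`
and `antip r`, in such a way that they remain orthogonal. This does not change the faces outside
`separating k r s`. -/
lemma IsFrame.replace (hΩ : Ω.IsAlt) (hn : 0 < n) (hV : Module.finrank F V = 2 * n)
    (hv : IsFrame Ω v) {r s : Fin n × Bool} (h1 : s ≠ r) (h2 : s ≠ antip r) {a b c d : F}
    (ha : a ≠ 0) (hc : c ≠ 0)
    (h : a * d * Ω (v r) (v (antip r)) + b * c * Ω (v s) (v (antip s)) = 0) :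
    ∃ hw : IsFrame Ω (replace v r (antip s) (a • v r + b • v s)
      (c • v (antip s) + d • v (antip r))),
      ∀ A : Face n k, A ∉ separating k r s → hv.face A = hw.face A := by
  have hsr : antip s ≠ r := fun h => h2 (antip_eq_comm.1 h).symm
  have hsr' : antip s ≠ antip r := fun h => h1 (antip_inj.1 h)
  have hrr := ne_antip r
  have hss := ne_antip s
  set x := a • v r + b • v s with hx
  set y := c • v (antip s) + d • v (antip r) with hy
  have hxv : ∀ u, u ≠ antip s → (Ω x (v u) ≠ 0 ↔ u = antip r) := by
    intro u hu
    rw [hx, map_add, map_smul, map_smul, LinearMap.add_apply, LinearMap.smul_apply,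
      LinearMap.smul_apply, hv.apply_eq_zero hu, smul_zero, add_zero, smul_ne_zero_iff, hv.1]
    exact and_iff_right ha
  have hyv : ∀ u, u ≠ r → (Ω y (v u) ≠ 0 ↔ u = s) := by
    intro u hu
    rw [hy, map_add, map_smul, map_smul, LinearMap.add_apply, LinearMap.smul_apply,
      LinearMap.smul_apply, hv.apply_eq_zero (r := antip r) (by rwa [antip_antip]), smul_zero,
      add_zero, smul_ne_zero_iff, hv.1, antip_antip]
    exact and_iff_right hc
  have hxy : Ω x y = 0 := by
    simp only [hx, hy, map_add, map_smul, LinearMap.add_apply, LinearMap.smul_apply, smul_eq_mul]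
    rw [hv.apply_eq_zero (r := r) (s := antip s) hsr',
      hv.apply_eq_zero (r := s) (s := antip r) hsr'.symm]
    linear_combination h
  have hw : IsFrame Ω (SymplecticGrassmannian.replace v r (antip s) x y) := by
    refine isFrame_of_apply hn hV fun t u => ?_
    by_cases ht : t = r
    · subst ht
      rw [replace_left]
      by_cases hu : u = t
      · subst hu
        rw [replace_left, hΩ]
        simp [hrr]
      · by_cases hu' : u = antip s
        · subst hu'
          rw [replace_right hu, hxy]
          simp [h1]
        · rw [replace_of_ne hu hu', hxv u hu']
    · by_cases ht' : t = antip s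
      · subst ht'
        rw [replace_right ht, antip_antip]
        by_cases hu : u = r
        · subst hu
          rw [replace_left, apply_ne_zero_comm hΩ, hxy]
          simp [h1.symm]
        · by_cases hu' : u = antip s
          · subst hu'
            rw [replace_right ht, hΩ]
            simp [hss.symm]
          · rw [replace_of_ne hu hu', hyv u hu]
      · rw [replace_of_ne ht ht']
        by_cases hu : u = r
        · subst hu
          rw [replace_left, apply_ne_zero_comm hΩ, hxv t ht', eq_comm, antip_eq_comm, eq_comm]
        · by_cases hu' : u = antip s
          · subst hu'
            rw [replace_right hu, apply_ne_zero_comm hΩ, hyv t ht, antip_inj, eq_comm]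
          · rw [replace_of_ne hu hu', hv.1]
  refine ⟨hw, fun A hA => ?_⟩
  have hA1 : r ∈ A.1 → s ∈ A.1 := fun h => by_contra fun h' => hA (Or.inl ⟨h, h'⟩)
  have hA2 : antip s ∈ A.1 → antip r ∈ A.1 := fun h => by_contra fun h' => hA (Or.inr ⟨h, h'⟩)
  have hws : SymplecticGrassmannian.replace v r (antip s) x y s = v s := replace_of_ne h1 hss _ _
  have hwr : SymplecticGrassmannian.replace v r (antip s) x y (antip r) = v (antip r) :=
    replace_of_ne (antip_ne r) hsr'.symm _ _
  apply Subtype.ext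
  rw [face_val, face_val]
  apply le_antisymm
  · rw [frameSpan_le]
    intro t ht
    by_cases h3 : t = r
    · subst h3
      have e : v t = a⁻¹ • (x - b • v s) := by rw [hx, add_sub_cancel_right, inv_smul_smul₀ ha]
      rw [e]
      refine Submodule.smul_mem _ _ (Submodule.sub_mem _ ?_ (Submodule.smul_mem _ _ ?_))
      · have := subset_frameSpan (F := F) (v := SymplecticGrassmannian.replace v t (antip s) x y) ht
        rwa [replace_left] at this
      · rw [← hws]
        exact subset_frameSpan (hA1 ht)
    · by_cases h4 : t = antip s
      · subst h4
        have e : v (antip s) = c⁻¹ • (y - d • v (antip r)) := by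
          rw [hy, add_sub_cancel_right, inv_smul_smul₀ hc]
        rw [e]
        refine Submodule.smul_mem _ _ (Submodule.sub_mem _ ?_ (Submodule.smul_mem _ _ ?_))
        · have := subset_frameSpan (F := F)
            (v := SymplecticGrassmannian.replace v r (antip s) x y) ht
          rwa [replace_right h3] at this
        · rw [← hwr]
          exact subset_frameSpan (hA2 ht)
      · have := subset_frameSpan (F := F)
          (v := SymplecticGrassmannian.replace v r (antip s) x y) ht
        rwa [replace_of_ne h3 h4] at this
  · rw [frameSpan_le]
    intro t ht
    by_cases h3 : t = r
    · subst h3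
      rw [replace_left, hx]
      exact Submodule.add_mem _ (Submodule.smul_mem _ _ (subset_frameSpan ht))
        (Submodule.smul_mem _ _ (subset_frameSpan (hA1 ht)))
    · by_cases h4 : t = antip s
      · subst h4
        rw [replace_right h3, hy]
        exact Submodule.add_mem _ (Submodule.smul_mem _ _ (subset_frameSpan ht))
          (Submodule.smul_mem _ _ (subset_frameSpan (hA2 ht)))
      · rw [replace_of_ne h3 h4]
        exact subset_frameSpan ht

/-- Two vertices which are neither equal nor antipodal give a triple of frames. -/
lemma IsFrame.exists_triple_separating (hΩ : Ω.IsAlt) (hn : 0 < n)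
    (hV : Module.finrank F V = 2 * n) (hv : IsFrame Ω v) {r s : Fin n × Bool} (h1 : s ≠ r)
    (h2 : s ≠ antip r) : ∃ (v₁ v₂ : Fin n × Bool → V) (h₁ : IsFrame Ω v₁) (h₂ : IsFrame Ω v₂),
      IsTriple hv h₁ h₂ (separating k r s) (separating k s r) := by
  -- `c` makes `v r + v s` and `v (antip s) + c • v (antip r)` orthogonal
  set c : F := -(Ω (v s) (v (antip s)) / Ω (v r) (v (antip r))) with hc
  have hr0 := hv.apply_antip r
  have hs0 := hv.apply_antip s
  have hc0 : c ≠ 0 := neg_ne_zero.2 (div_ne_zero hs0 hr0)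
  have hcr : c * Ω (v r) (v (antip r)) + Ω (v s) (v (antip s)) = 0 := by
    rw [hc]; field_simp; ring
  have h2' : r ≠ antip s := fun h => h2 (antip_eq_comm.1 h.symm).symm
  obtain ⟨h₁, hf₁⟩ := hv.replace (k := k) hΩ hn hV h1 h2 (a := 1) (b := 1) (c := 1) (d := c)
    one_ne_zero one_ne_zero (by linear_combination hcr)
  obtain ⟨h₂, hf₂⟩ := hv.replace (k := k) hΩ hn hV h1.symm h2' (a := 1) (b := 1) (c := c) (d := 1)
    one_ne_zero hc0 (by linear_combination hcr)
  have h3 : antip s ≠ antip r := fun h => h1 (antip_inj.1 h)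
  have h4 : r ≠ antip r := ne_antip r
  have h5 : s ≠ antip s := ne_antip s
  let π : Equiv.Perm (Fin n × Bool) := (Equiv.swap r s) * Equiv.swap (antip r) (antip s)
  have hπr : π r = s := by
    change Equiv.swap r s (Equiv.swap (antip r) (antip s) r) = s
    rw [Equiv.swap_apply_of_ne_of_ne h4 h2', Equiv.swap_apply_left]
  have hπs : π s = r := by
    change Equiv.swap r s (Equiv.swap (antip r) (antip s) s) = r
    rw [Equiv.swap_apply_of_ne_of_ne h2 h5, Equiv.swap_apply_right]
  have hπr' : π (antip r) = antip s := by
    change Equiv.swap r s (Equiv.swap (antip r) (antip s) (antip r)) = antip s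
    rw [Equiv.swap_apply_left, Equiv.swap_apply_of_ne_of_ne h2'.symm h5.symm]
  have hπs' : π (antip s) = antip r := by
    change Equiv.swap r s (Equiv.swap (antip r) (antip s) (antip s)) = antip r
    rw [Equiv.swap_apply_right, Equiv.swap_apply_of_ne_of_ne h4.symm h2.symm]
  have hπt : ∀ t, t ≠ r → t ≠ s → t ≠ antip r → t ≠ antip s → π t = t := by
    intro t e1 e2 e3 e4
    change Equiv.swap r s (Equiv.swap (antip r) (antip s) t) = t
    rw [Equiv.swap_apply_of_ne_of_ne e3 e4, Equiv.swap_apply_of_ne_of_ne e1 e2]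
  have hπ : ∀ t, π (antip t) = antip (π t) := by
    intro t
    by_cases e1 : t = r
    · rw [e1, hπr, hπr']
    by_cases e2 : t = s
    · rw [e2, hπs, hπs']
    by_cases e3 : t = antip r
    · rw [e3, hπr', antip_antip, antip_antip, hπr]
    by_cases e4 : t = antip s
    · rw [e4, hπs', antip_antip, antip_antip, hπs]
    rw [hπt t e1 e2 e3 e4, hπt]
    · exact fun h => e3 (antip_eq_comm.1 h).symm
    · exact fun h => e4 (antip_eq_comm.1 h).symm
    · exact fun h => e1 (antip_inj.1 h)
    · exact fun h => e2 (antip_inj.1 h)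
  have hmem : ∀ {x y : Fin n × Bool} {A : Face n k}, A ∈ separating k x y →
      y ∉ A.1 ∧ antip x ∉ A.1 := by
    rintro x y A (⟨e1, e2⟩ | ⟨e1, e2⟩)
    · exact ⟨e2, A.2.2 x e1⟩
    · exact ⟨Face.antip_not_mem e1, e2⟩
  have hmap : ∀ (A : Face n k) (x y : Fin n × Bool), π x = y →
      (y ∈ (A.map π hπ π.injective).1 ↔ x ∈ A.1) := by
    intro A x y h
    rw [← h]
    exact Face.mem_map hπ π.injective
  refine ⟨_, _, h₁, h₂, separating_disjoint r s, hf₁, hf₂, ?_⟩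
  · intro A hA
    obtain ⟨e1, e2⟩ := hmem hA
    refine ⟨A.map π hπ π.injective, ?_, h₁.face_map h₂ hπ π.injective ?_⟩
    · rw [mem_separating, hmap A _ _ hπr, hmap A _ _ hπs, hmap A _ _ hπr', hmap A _ _ hπs']
      exact hA
    · intro t ht
      have e3 : t ≠ s := fun h => e1 (h ▸ ht)
      have e4 : t ≠ antip r := fun h => e2 (h ▸ ht)
      by_cases e5 : t = r
      · rw [e5, hπr, replace_left, replace_left, add_comm]
      by_cases e6 : t = antip s
      · rw [e6, hπs', replace_right h2.symm, replace_right h2'.symm, add_comm]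
      rw [hπt t e5 e3 e4 e6, replace_of_ne e3 e4, replace_of_ne e5 e6]

end Triples

/-! ### Opposition -/

section Opposition

variable {F V : Type*} [Field F] [AddCommGroup V] [Module F V]
  {n k : ℕ} {Ω : LinearMap.BilinForm F V} {v w : Fin n × Bool → V}

/-- Opposition of totally isotropic subspaces: no non-zero vector of `T` is orthogonal to `S`. -/
def IsOpposite (Ω : LinearMap.BilinForm F V) (S T : Submodule F V) : Prop :=
  ∀ y ∈ T, (∀ x ∈ S, Ω y x = 0) → y = 0

lemma IsFrame.isOpposite_face (hv : IsFrame Ω v) {A B : Face n k} :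
    IsOpposite Ω (hv.face A).1 (hv.face B).1 ↔ B = A.opp := by
  constructor
  · refine fun h => Face.eq_of_subset fun b hb => ?_
    rw [Face.mem_opp]
    by_contra hbA
    refine hv.ne_zero b (h _ (subset_frameSpan hb) ?_)
    rw [face_val, ← hv.mem_frameSpan_orthogonal]
    exact subset_frameSpan hbA
  · rintro rfl y hy h
    have : y ∈ frameSpan F v ∅ := by
      rw [hv.mem_frameSpan]
      intro s _
      by_cases hs : s ∈ A.opp.1
      · exact h _ (subset_frameSpan (Face.mem_opp.1 hs))
      · exact hv.mem_frameSpan.1 hy s hs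
    simpa [frameSpan] using this

end Opposition

/-! ### Maps that send base subsets to base subsets -/

section Maps

variable {F V F' V' : Type*} [Field F] [AddCommGroup V] [Module F V]
  [Field F'] [AddCommGroup V'] [Module F' V'] {n k : ℕ} {Ω : LinearMap.BilinForm F V}
  {Ω' : LinearMap.BilinForm F' V'} {f : Grassmannian Ω k → Grassmannian Ω' k}

/-- The map `f` sends the base subset of every frame bijectively onto the base subset of a frame. -/
def PermutesFaces (n : ℕ) (f : Grassmannian Ω k → Grassmannian Ω' k) : Prop :=
  ∀ (v : Fin n × Bool → V) (hv : IsFrame Ω v), ∃ (v' : Fin n × Bool → V') (hv' : IsFrame Ω' v')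
    (σ : Equiv.Perm (Face n k)), ∀ A, f (hv.face A) = hv'.face (σ A)

/-- On the base subset of every frame, the map `f` is given by a map of frames: the bijection of
vertices is absorbed in the labelling of the second frame. -/
def InducedOnFrames (n : ℕ) (f : Grassmannian Ω k → Grassmannian Ω' k) : Prop :=
  ∀ (v : Fin n × Bool → V) (hv : IsFrame Ω v), ∃ (v' : Fin n × Bool → V') (hv' : IsFrame Ω' v'),
    ∀ A : Face n k, f (hv.face A) = hv'.face A

lemma permutesFaces_of_isBaseSubset (hn : 0 < n) (hV' : Module.finrank F' V' = 2 * n)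
    (hΩ' : Ω'.IsAlt) (hf : ∀ X, IsBaseSubset Ω k X → IsBaseSubset Ω' k (f '' X)) :
    PermutesFaces n f := by
  intro v hv
  obtain ⟨B, hB, hX⟩ := hf _ hv.isBaseSubset
  obtain ⟨v', hv', rfl⟩ := hB.exists_frame hn hV' hΩ'
  rw [hv'.baseSubset_range] at hX
  have h1 : ∀ A, ∃ A', f (hv.face A) = hv'.face (k := k) A' := by
    intro A
    obtain ⟨A', hA'⟩ : f (hv.face A) ∈ Set.range (hv'.face (k := k)) :=
      hX ▸ ⟨_, ⟨A, rfl⟩, rfl⟩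
    exact ⟨A', hA'.symm⟩
  choose σ hσ using h1
  have hsurj : Function.Surjective σ := by
    intro A'
    obtain ⟨_, ⟨A, rfl⟩, hA⟩ : hv'.face A' ∈ f '' Set.range (hv.face (k := k)) := hX ▸ ⟨A', rfl⟩
    exact ⟨A, hv'.face_injective (by rw [← hσ, hA])⟩
  exact ⟨v', hv', Equiv.ofBijective σ (Finite.injective_iff_bijective.1
    (Finite.injective_iff_surjective.2 hsurj)), hσ⟩

/-- For a triple of frames, the image under `f` of the part of `X₁` consists of the elements of one
base subset that do not belong to another one, so it corresponds to a union of generating sets. -/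
lemma PermutesFaces.image_isUnion (hf : PermutesFaces n f) {v v₁ v₂ : Fin n × Bool → V}
    {v' : Fin n × Bool → V'} {hv : IsFrame Ω v} {h₁ : IsFrame Ω v₁} {h₂ : IsFrame Ω v₂}
    {X₁ X₂ : Set (Face n k)} (ht : IsTriple hv h₁ h₂ X₁ X₂) (hv' : IsFrame Ω' v')
    {σ : Equiv.Perm (Face n k)} (hσ : ∀ A, f (hv.face A) = hv'.face (σ A)) :
    IsUnionOfGenerating (σ '' X₁) := by
  obtain ⟨v₁', h₁', σ₁, hσ₁⟩ := hf v₁ h₁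
  obtain ⟨v₂', h₂', σ₂, hσ₂⟩ := hf v₂ h₂
  have : σ '' X₁ = {A | hv'.face A ∉ Set.range (h₁'.face (k := k))} := by
    ext A
    obtain ⟨A, rfl⟩ := σ.surjective A
    rw [σ.injective.mem_set_image, Set.mem_ofPred_eq, ← hσ]
    constructor
    · rintro hA ⟨C, hC⟩
      obtain ⟨C, rfl⟩ := σ₁.surjective C
      rw [← hσ₁] at hC
      by_cases hCX : C ∈ X₁
      · obtain ⟨D, hD, hCD⟩ := ht.exists_face_eq C hCX
        have hAX : A ∉ X₂ := Set.disjoint_left.1 ht.disjoint hA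
        rw [hCD, ht.face_eq₂ A hAX, hσ₂, hσ₂] at hC
        exact hAX (σ₂.injective (h₂'.face_injective hC) ▸ hD)
      · rw [← ht.face_eq₁ C hCX, hσ, hσ] at hC
        exact hCX (σ.injective (hv'.face_injective hC) ▸ hA)
    · intro hA
      by_contra hAX
      rw [ht.face_eq₁ A hAX, hσ₁] at hA
      exact hA ⟨_, rfl⟩
  rw [this]
  exact hv'.isUnionOfGenerating_notMem_range h₁'

/-- For a triple of frames, let `A` be a face in the common part. If the element opposite to the
image of `A` in the first base subset came from the part of `X₁`, then it would come from the third
part in the base subset of `v₁`, and there would be two such elements in the base subset of `v₂`. -/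
lemma PermutesFaces.notMem_of_isOpposite (hf : PermutesFaces n f) {v v₁ v₂ : Fin n × Bool → V}
    {hv : IsFrame Ω v} {h₁ : IsFrame Ω v₁} {h₂ : IsFrame Ω v₂}
    {X₁ X₂ : Set (Face n k)} (ht : IsTriple hv h₁ h₂ X₁ X₂) {A B : Face n k} (hA₁ : A ∉ X₁)
    (hA₂ : A ∉ X₂) (hAB : IsOpposite Ω' (f (hv.face A)).1 (f (hv.face B)).1) : B ∉ X₁ := by
  intro hB
  have huniq : ∀ {u : Fin n × Bool → V} (hu : IsFrame Ω u) (A : Face n k),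
      ∃ B : Face n k, IsOpposite Ω' (f (hu.face A)).1 (f (hu.face B)).1 ∧
        ∀ C : Face n k, IsOpposite Ω' (f (hu.face A)).1 (f (hu.face C)).1 → C = B := by
    intro u hu A
    obtain ⟨u', hu', σ, hσ⟩ := hf u hu
    refine ⟨σ.symm (σ A).opp, ?_, fun C hC => ?_⟩
    · rw [hσ, hσ, hu'.isOpposite_face, σ.apply_symm_apply]
    · rw [hσ, hσ, hu'.isOpposite_face] at hC
      rw [← hC, σ.symm_apply_apply]
  have hBX : B ∉ X₂ := Set.disjoint_left.1 ht.disjoint hB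
  obtain ⟨C, hC, -⟩ := huniq h₁ A
  rw [← ht.face_eq₁ A hA₁] at hC
  by_cases hCX : C ∈ X₁
  · obtain ⟨D, hD, hCD⟩ := ht.exists_face_eq C hCX
    obtain ⟨E, -, hE⟩ := huniq h₂ A
    rw [hCD, ht.face_eq₂ A hA₂] at hC
    rw [ht.face_eq₂ A hA₂, ht.face_eq₂ B hBX] at hAB
    exact hBX (((hE B hAB).trans (hE D hC).symm) ▸ hD)
  · rw [← ht.face_eq₁ C hCX] at hC
    obtain ⟨E, -, hE⟩ := huniq hv A
    exact hCX (((hE B hAB).trans (hE C hC).symm) ▸ hB)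

/-- The permutation of faces given by `f` preserves opposition. -/
lemma PermutesFaces.apply_opp (hΩ : Ω.IsAlt) (hn : 0 < n) (hV : Module.finrank F V = 2 * n)
    (hf : PermutesFaces n f) {v : Fin n × Bool → V} {v' : Fin n × Bool → V'} (hv : IsFrame Ω v)
    (hv' : IsFrame Ω' v') {σ : Equiv.Perm (Face n k)}
    (hσ : ∀ A, f (hv.face A) = hv'.face (σ A)) (A : Face n k) : σ A.opp = (σ A).opp := by
  obtain ⟨B, hB⟩ := σ.surjective (σ A).opp
  have hAB : IsOpposite Ω' (f (hv.face A)).1 (f (hv.face B)).1 := by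
    rw [hσ, hσ, hv'.isOpposite_face, hB]
  have hBA : IsOpposite Ω' (f (hv.face B)).1 (f (hv.face A)).1 := by
    rw [hσ, hσ, hv'.isOpposite_face, hB, Face.opp_opp]
  have hne : A ≠ B := fun h => (σ A).opp_ne (by rw [← hB, h])
  have hstar : ∀ r, r ∈ A.1 → r ∈ B.1 ∨ antip r ∈ B.1 := by
    intro r hr
    by_contra! h
    obtain ⟨v₁, v₂, h₁, h₂, ht⟩ := hv.exists_triple_star (k := k) hΩ hn hV r
    exact hf.notMem_of_isOpposite ht h.1 h.2 hBA hr
  have hsep : ∀ r s, s ≠ r → s ≠ antip r → A ∈ separating k r s →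
      B ∈ separating k r s ∨ B ∈ separating k s r := by
    intro r s h1 h2 hA
    by_contra! h
    obtain ⟨v₁, v₂, h₁, h₂, ht⟩ := hv.exists_triple_separating (k := k) hΩ hn hV h1 h2
    exact hf.notMem_of_isOpposite ht h.1 h.2 hBA hA
  suffices h : B = A.opp by rw [← h, hB]
  refine (Face.eq_of_subset fun r hr => ?_).symm
  obtain ⟨q, rfl⟩ : ∃ q, r = antip q := ⟨antip r, (antip_antip r).symm⟩
  have hqA : q ∈ A.1 := by simpa using hr
  refine (hstar q hqA).resolve_left fun hqB => hne (Face.eq_of_subset fun t ht => ?_)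
  -- `A` and `B` share the vertex `q`, so they agree at every other vertex of `A`
  by_contra htB
  have ht' : antip t ∈ B.1 := (hstar t ht).resolve_left htB
  have h1 : antip t ≠ q := fun h => A.2.2 t ht (h ▸ hqA)
  have h2 : antip t ≠ antip q := fun h => htB (antip_inj.1 h ▸ hqB)
  rcases hsep q (antip t) h1 h2 (Or.inl ⟨hqA, A.2.2 t ht⟩) with (h | h) | (h | h)
  · exact h.2 ht'
  · exact htB (by simpa using h.1)
  · exact h.2 hqB
  · exact B.2.2 q hqB h.1

/-- A map which sends base subsets to base subsets is, on each base subset, given by a bijection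
of frames. -/
theorem PermutesFaces.inducedOnFrames (hΩ : Ω.IsAlt) (hkn : k < n)
    (hV : Module.finrank F V = 2 * n) (hV' : Module.finrank F' V' = 2 * n)
    (hf : PermutesFaces n f) : InducedOnFrames n f := by
  have hn : 0 < n := by omega
  intro v hv
  obtain ⟨v', hv', σ, hσ⟩ := hf v hv
  have hgen : ∀ X : Set (Face n k), IsGenerating X → IsUnionOfGenerating (σ '' X) := by
    rintro X (⟨r, rfl⟩ | ⟨r, s, h1, h2, rfl⟩)
    · obtain ⟨v₁, v₂, h₁, h₂, ht⟩ := hv.exists_triple_star (k := k) hΩ hn hV r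
      exact hf.image_isUnion ht hv' hσ
    · obtain ⟨v₁, v₂, h₁, h₂, ht⟩ := hv.exists_triple_separating (k := k) hΩ hn hV h1 h2
      exact hf.image_isUnion ht hv' hσ
  obtain ⟨τ, hτ, hinj, hmem⟩ := exists_perm_vertices hkn hgen (hf.apply_opp hΩ hn hV hv hv' hσ)
  have hw : IsFrame Ω' (v' ∘ τ) := by
    refine isFrame_of_apply hn hV' fun r s => ?_
    rw [Function.comp_apply, Function.comp_apply, hv'.1, ← hτ, hinj.eq_iff]
  refine ⟨_, hw, fun A => ?_⟩
  rw [hσ, hw.face_map hv' hτ hinj (fun _ _ => rfl)]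
  congr 1
  refine (Face.eq_of_subset fun r hr => ?_).symm
  obtain ⟨s, hs, rfl⟩ := Finset.mem_image.1 hr
  exact (hmem A s).1 hs

end Maps

/-! ### Extension of partial frames -/

section Extension

variable {F V : Type*} [Field F] [AddCommGroup V] [Module F V]
  {n k : ℕ} {Ω : LinearMap.BilinForm F V} {v : Fin n × Bool → V} {J : Set (Fin n × Bool)}

/-- A part of a frame: independent vectors at the vertices in `J` with the orthogonality relations
of a frame. The values of `v` outside `J` are irrelevant. -/
structure IsPartialFrame (Ω : LinearMap.BilinForm F V) (J : Set (Fin n × Bool))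
    (v : Fin n × Bool → V) : Prop where
  linearIndepOn : LinearIndepOn F v J
  apply_ne_zero_iff : ∀ r ∈ J, ∀ s ∈ J, Ω (v r) (v s) ≠ 0 ↔ s = antip r

lemma IsPartialFrame.insertVector (hΩ : Ω.IsAlt) (hv : IsPartialFrame Ω J v) {r : Fin n × Bool}
    (hr : r ∉ J) {x : V} (hx : x ∉ frameSpan F v J)
    (h : ∀ s ∈ J, Ω x (v s) ≠ 0 ↔ s = antip r) :
    IsPartialFrame Ω (insert r J) (Function.update v r x) := by
  have hne : ∀ s ∈ J, s ≠ r := fun s hs h => hr (h ▸ hs)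
  have heq : Set.EqOn v (Function.update v r x) J := fun s hs =>
    (Function.update_of_ne (hne s hs) _ _).symm
  refine ⟨(hv.1.congr heq).insert ?_, ?_⟩
  · rw [Function.update_self, ← heq.image_eq]
    exact hx
  · rintro t (rfl | ht) u (rfl | hu)
    · rw [Function.update_self, hΩ]
      simp [ne_antip]
    · rw [Function.update_self, ← heq hu, h u hu]
    · rw [Function.update_self, ← heq ht, apply_ne_zero_comm hΩ, h t ht, eq_comm,
        antip_eq_comm, eq_comm]
    · rw [← heq ht, ← heq hu, hv.2 t ht u hu]

lemma IsPartialFrame.exists_insert (hΩ : Ω.IsAlt) (hΩn : Ω.Nondegenerate)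
    (hV : Module.finrank F V = 2 * n) [Module.Finite F V]
    (hv : IsPartialFrame Ω J v) (hJ : J ≠ Set.univ) :
    ∃ r ∉ J, ∃ x, IsPartialFrame Ω (insert r J) (Function.update v r x) := by
  by_cases hex : ∃ r ∉ J, antip r ∈ J
  · obtain ⟨r, hr, hr'⟩ := hex
    -- a vector orthogonal to all given ones but the one at `antip r`
    have hins : insert (antip r) (J \ {antip r}) = J := by
      rw [Set.insert_sdiff_singleton, Set.insert_eq_of_mem hr']
    have h1 : v (antip r) ∉ frameSpan F v (J \ {antip r}) := by
      have := hv.1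
      rw [← hins, linearIndepOn_insert (by simp)] at this
      exact this.2
    obtain ⟨φ, hφ1, hφ2⟩ := Submodule.exists_le_ker_of_notMem h1
    set x := (Ω.toDual hΩn).symm φ with hx
    have hxφ : ∀ y, Ω x y = φ y := fun y =>
      LinearMap.BilinForm.apply_toDual_symm_apply (hB := hΩn) φ y
    have h2 : ∀ s ∈ J, Ω x (v s) ≠ 0 ↔ s = antip r := by
      intro s hs
      rw [hxφ]
      by_cases hsr : s = antip r
      · rw [hsr]
        exact iff_of_true hφ1 rfl
      · refine iff_of_false (not_not.2 ?_) hsr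
        exact LinearMap.mem_ker.1 (hφ2 (subset_frameSpan ⟨hs, hsr⟩))
    refine ⟨r, hr, x, hv.insertVector hΩ hr (fun hxJ => ?_) h2⟩
    refine (h2 _ hr').2 rfl ?_
    refine Submodule.span_induction (p := fun y _ => Ω y (v (antip r)) = 0) ?_ ?_ ?_ ?_ hxJ
    · rintro _ ⟨s, hs, rfl⟩
      by_contra h
      exact hr (antip_inj.1 ((hv.2 s hs _ hr').1 h) ▸ hs)
    · simp
    · intro x y _ _ hx hy
      rw [map_add, LinearMap.add_apply, hx, hy, add_zero]
    · intro a x _ hx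
      rw [map_smul, LinearMap.smul_apply, hx, smul_zero]
  · push Not at hex
    obtain ⟨r, hr⟩ := (Set.ne_univ_iff_exists_notMem J).1 hJ
    classical
    obtain ⟨K, rfl⟩ : ∃ K : Finset (Fin n × Bool), (K : Set (Fin n × Bool)) = J :=
      ⟨J.toFinset, by simp⟩
    have hclosed : ∀ s ∈ K, antip s ∈ K := fun s hs => by
      by_contra h
      exact hex (antip s) h (by simpa using hs)
    -- `J` is closed under the antipodal map, so any vector orthogonal to it will do
    have hcard : Module.finrank F (K → F) < Module.finrank F V := by
      rw [Module.finrank_fintype_fun_eq_card, Fintype.card_coe, hV, ← card_vertices]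
      exact Finset.card_lt_univ_of_notMem hr
    obtain ⟨x, hx, hx0⟩ := Submodule.exists_mem_ne_zero_of_ne_bot
      (LinearMap.ker_ne_bot_of_finrank_lt (f := LinearMap.pi fun s : K => LinearMap.flip Ω (v s)) hcard)
    have hxs : ∀ s ∈ K, Ω x (v s) = 0 := fun s hs => congrFun (LinearMap.mem_ker.1 hx) ⟨s, hs⟩
    refine ⟨r, hr, x, hv.insertVector hΩ hr (fun hxJ => hx0 ?_) fun s hs => ?_⟩
    · obtain ⟨c, rfl⟩ := (Submodule.mem_span_image_finset_iff_exists_fun' F).1 hxJ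
      refine Finset.sum_eq_zero fun s hs => ?_
      have h1 := hxs _ (hclosed s hs)
      rw [map_sum, LinearMap.sum_apply, Finset.sum_eq_single_of_mem s hs] at h1
      · rw [map_smul, LinearMap.smul_apply, smul_eq_mul] at h1
        rw [(mul_eq_zero.1 h1).resolve_right ((hv.2 s hs _ (hclosed s hs)).2 rfl), zero_smul]
      · intro t ht hts
        rw [map_smul, LinearMap.smul_apply, not_not.1 (mt (hv.2 t ht _ (hclosed s hs)).1
          (fun h => hts (antip_inj.1 h).symm)), smul_zero]
    · refine iff_of_false (not_not.2 (hxs s hs)) fun h => ?_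
      exact hr (by simpa [h] using hclosed s hs)

/-- Every partial frame extends to a frame. -/
lemma IsPartialFrame.exists_isFrame (hΩ : Ω.IsAlt) (hΩn : Ω.Nondegenerate) (hn : 0 < n)
    (hV : Module.finrank F V = 2 * n) (hv : IsPartialFrame Ω J v) :
    ∃ w, IsFrame Ω w ∧ Set.EqOn w v J := by
  have hfin : Module.Finite F V := Module.finite_of_finrank_pos (by omega)
  induction hm : (Jᶜ).ncard generalizing J v with
  | zero =>
    have hJ : J = Set.univ := Set.compl_empty_iff.1 ((Set.ncard_eq_zero).1 hm)
    subst hJ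
    exact ⟨v, isFrame_of_apply hn hV fun r s => hv.2 r trivial s trivial, fun _ _ => rfl⟩
  | succ m ih =>
    have hJ : J ≠ Set.univ := by
      rintro rfl
      simp at hm
    obtain ⟨r, hr, x, hx⟩ := hv.exists_insert hΩ hΩn hV hJ
    have hcard : ((insert r J)ᶜ).ncard = m := by
      have h1 : (insert r J)ᶜ = Jᶜ \ {r} := by
        ext t; simp [not_or, and_comm]
      rw [h1, Set.ncard_sdiff_singleton_of_mem (by exact hr), hm]
      rfl
    obtain ⟨w, hw, hwv⟩ := ih hx hcard
    refine ⟨w, hw, fun s hs => ?_⟩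
    rw [hwv (Set.mem_insert_of_mem r hs), Function.update_of_ne]
    rintro rfl
    exact hr hs

/-- The vertices `(i, false)` with `i < m`. -/
def initialVertices (n m : ℕ) : Set (Fin n × Bool) := {r | r.1.1 < m ∧ r.2 = false}

/-- A basis of a totally isotropic subspace is a partial frame. -/
lemma exists_isPartialFrame {m : ℕ} {H : Submodule F V} [Module.Finite F V]
    (hm : Module.finrank F H = m) (hmn : m ≤ n) (hH : IsTotallyIsotropic Ω H) :
    ∃ v : Fin n × Bool → V, IsPartialFrame Ω (initialVertices n m) v ∧
      frameSpan F v (initialVertices n m) = H := by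
  let b : Module.Basis (Fin m) F H := Module.finBasisOfFinrankEq F H hm
  let v : Fin n × Bool → V := fun r => if h : r.1.1 < m then b ⟨r.1.1, h⟩ else 0
  have hv : ∀ r (h : r ∈ initialVertices n m), v r = b ⟨r.1.1, h.1⟩ := fun r h => dif_pos h.1
  have himage : v '' initialVertices n m = Set.range (fun i => (b i : V)) := by
    ext x
    constructor
    · rintro ⟨r, hr, rfl⟩
      exact ⟨_, (hv r hr).symm⟩
    · rintro ⟨i, rfl⟩
      have hi : ((⟨i.1, by omega⟩, false) : Fin n × Bool) ∈ initialVertices n m := ⟨i.2, rfl⟩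
      exact ⟨_, hi, hv _ hi⟩
  refine ⟨v, ⟨?_, ?_⟩, ?_⟩
  · have h1 : LinearIndependent F (fun i => (b i : V)) :=
      b.linearIndependent.map' H.subtype (Submodule.ker_subtype H)
    have h2 := h1.comp (fun r : initialVertices n m => (⟨r.1.1.1, r.2.1⟩ : Fin m)) (by
      rintro ⟨⟨i, c⟩, hr⟩ ⟨⟨j, d⟩, hs⟩ h
      have h3 : i = j := Fin.ext (Fin.mk.inj_iff.1 h)
      have h4 : c = false := hr.2
      have h5 : d = false := hs.2
      subst h3 h4 h5
      rfl)
    have h3 : (fun r : initialVertices n m => v r.1) =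
        (fun i => (b i : V)) ∘ fun r : initialVertices n m => (⟨r.1.1.1, r.2.1⟩ : Fin m) :=
      funext fun r => hv r.1 r.2
    rw [LinearIndepOn, h3]
    exact h2
  · intro r hr s hs
    refine iff_of_false (not_not.2 ?_) ?_
    · rw [hv r hr, hv s hs]
      exact isTotallyIsotropic_iff.1 hH _ (b _).2 _ (b _).2
    · rintro rfl
      have h1 := hr.2
      have h2 := hs.2
      simp [antip, h1] at h2
  · rw [frameSpan, himage]
    have h1 : Set.range (fun i => (b i : V)) = H.subtype '' Set.range b := by
      rw [← Set.range_comp]; rfl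
    rw [h1, Submodule.span_image, b.span_eq, Submodule.map_top, Submodule.range_subtype]

lemma finrank_le_of_isTotallyIsotropic (hΩn : Ω.Nondegenerate) [Module.Finite F V]
    (hV : Module.finrank F V = 2 * n) {S : Submodule F V} (hS : IsTotallyIsotropic Ω S) :
    Module.finrank F S ≤ n := by
  rw [isTotallyIsotropic_iff] at hS
  have h1 : S ≤ Ω.orthogonal S := fun x hx y hy => hS y hy x hx
  have h2 := Submodule.finrank_mono h1
  rw [LinearMap.BilinForm.finrank_orthogonal hΩn, hV] at h2
  omega

/-- Every totally isotropic subspace is spanned by a part of a frame. -/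
lemma exists_frameSpan_eq (hΩ : Ω.IsAlt) (hΩn : Ω.Nondegenerate) (hn : 0 < n)
    (hV : Module.finrank F V = 2 * n) {H : Submodule F V} (hH : IsTotallyIsotropic Ω H) :
    ∃ (v : Fin n × Bool → V) (_ : IsFrame Ω v) (P : Set (Fin n × Bool)), H = frameSpan F v P := by
  have hfin : Module.Finite F V := Module.finite_of_finrank_pos (by omega)
  obtain ⟨v, hv, hvH⟩ := exists_isPartialFrame rfl
    (finrank_le_of_isTotallyIsotropic hΩn hV hH) hH
  obtain ⟨w, hw, hwv⟩ := hv.exists_isFrame hΩ hΩn hn hV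
  refine ⟨w, hw, initialVertices n (Module.finrank F H), ?_⟩
  conv_lhs => rw [← hvH]
  rw [frameSpan, frameSpan, hwv.image_eq]

lemma isTotallyIsotropic_sup_span {H : Submodule F V} (hΩ : Ω.IsAlt)
    (hH : IsTotallyIsotropic Ω H) {x : V} (hx : ∀ y ∈ H, Ω x y = 0) :
    IsTotallyIsotropic Ω (H ⊔ Submodule.span F {x}) := by
  rw [isTotallyIsotropic_iff] at hH ⊢
  intro a ha b hb
  obtain ⟨a, haH, a', ha', rfl⟩ := Submodule.mem_sup.1 ha
  obtain ⟨b, hbH, b', hb', rfl⟩ := Submodule.mem_sup.1 hb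
  obtain ⟨c, rfl⟩ := Submodule.mem_span_singleton.1 ha'
  obtain ⟨d, rfl⟩ := Submodule.mem_span_singleton.1 hb'
  have h1 : Ω a x = 0 := by rw [← hΩ.neg_eq, hx a haH, neg_zero]
  simp [hH a haH b hbH, h1, hx b hbH, hΩ x]

/-- A totally isotropic subspace `H` and two vectors orthogonal to it, independent modulo `H`,
belong to a common frame. -/
lemma exists_frame_of_pair (hΩ : Ω.IsAlt) (hΩn : Ω.Nondegenerate) (hn : 0 < n)
    (hV : Module.finrank F V = 2 * n) {H : Submodule F V} (hH : IsTotallyIsotropic Ω H) {x y : V}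
    (hxH : ∀ z ∈ H, Ω x z = 0) (hyH : ∀ z ∈ H, Ω y z = 0) (hx : x ∉ H)
    (hy : y ∉ H ⊔ Submodule.span F {x}) :
    ∃ (v : Fin n × Bool → V) (_ : IsFrame Ω v) (P : Set (Fin n × Bool)) (r s : Fin n × Bool),
      H = frameSpan F v P ∧ v r = x ∧ v s = y := by
  have hfin : Module.Finite F V := Module.finite_of_finrank_pos (by omega)
  set m := Module.finrank F H with hm
  have hHx := isTotallyIsotropic_sup_span hΩ hH hxH
  have hmn := finrank_le_of_isTotallyIsotropic hΩn hV hHx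
  rw [Submodule.finrank_sup_span_singleton hx, ← hm] at hmn
  set J := initialVertices n m with hJ
  obtain ⟨v, hv, hvH⟩ := exists_isPartialFrame (n := n) hm.symm (by omega) hH
  rw [← hJ] at hv hvH
  have hvJ : ∀ s ∈ J, v s ∈ H := fun s hs => hvH ▸ subset_frameSpan hs
  set r : Fin n × Bool := (⟨m, by omega⟩, false) with hr
  have hrJ : r ∉ J := fun h => lt_irrefl _ h.1
  have hrJ' : antip r ∉ J := fun h => lt_irrefl _ h.1
  have hvx := hv.insertVector hΩ hrJ (x := x) (by rwa [hvH]) fun s hs =>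
    iff_of_false (not_not.2 (hxH _ (hvJ s hs))) (fun h => hrJ' (h ▸ hs))
  have hspan : frameSpan F (Function.update v r x) (insert r J) = H ⊔ Submodule.span F {x} := by
    have h1 : Set.EqOn (Function.update v r x) v J := fun s hs =>
      Function.update_of_ne (fun h => hrJ (by rwa [h] at hs)) _ _
    rw [frameSpan, Set.image_insert_eq, Function.update_self, h1.image_eq, Submodule.span_insert,
      sup_comm, ← hvH]
    rfl
  -- the position of `y` depends on whether it is orthogonal to `x`
  obtain ⟨s, hsr, hsJ, hsJ', hys⟩ : ∃ s : Fin n × Bool, s ≠ r ∧ s ∉ J ∧ antip s ∉ J ∧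
      (Ω y x ≠ 0 ↔ r = antip s) := by
    by_cases hxy : Ω y x = 0
    · have hHxy : IsTotallyIsotropic Ω ((H ⊔ Submodule.span F {x}) ⊔ Submodule.span F {y}) := by
        refine isTotallyIsotropic_sup_span hΩ hHx fun z hz => ?_
        obtain ⟨z, hzH, z', hz', rfl⟩ := Submodule.mem_sup.1 hz
        obtain ⟨c, rfl⟩ := Submodule.mem_span_singleton.1 hz'
        rw [map_add, map_smul, hxy, hyH z hzH, smul_zero, add_zero]
      have hmn' := finrank_le_of_isTotallyIsotropic hΩn hV hHxy
      rw [Submodule.finrank_sup_span_singleton hy, Submodule.finrank_sup_span_singleton hx,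
        ← hm] at hmn'
      have hlt : ∀ c : Bool, ((⟨m + 1, by omega⟩, c) : Fin n × Bool) ∉ J := fun c h => by
        have h2 : m + 1 < m := h.1
        omega
      refine ⟨(⟨m + 1, by omega⟩, false), ?_, hlt _, hlt _, ?_⟩
      · simp [hr]
      · simp [hxy, hr, antip]
    · exact ⟨antip r, antip_ne r, hrJ', by rwa [antip_antip], by simp [hxy]⟩
  have hvy := hvx.insertVector hΩ (r := s) (x := y) (by simp [hsr, hsJ]) (by rwa [hspan]) (by
    rintro t (rfl | ht)
    · rw [Function.update_self, hys]
    · rw [Function.update_of_ne (fun h => hrJ (by rwa [h] at ht))]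
      exact iff_of_false (not_not.2 (hyH _ (hvJ t ht))) (fun h => hsJ' (h ▸ ht)))
  obtain ⟨w, hw, hwv⟩ := hvy.exists_isFrame hΩ hΩn hn hV
  refine ⟨w, hw, J, r, s, ?_, ?_, ?_⟩
  · rw [← hvH, frameSpan, frameSpan]
    congr 1
    refine Set.image_congr fun t ht => ?_
    rw [hwv (by simp [ht]), Function.update_of_ne (fun h => hsJ (by rwa [h] at ht)),
      Function.update_of_ne (fun h => hrJ (by rwa [h] at ht))]
  · rw [hwv (by simp), Function.update_of_ne hsr.symm, Function.update_self]
  · rw [hwv (by simp), Function.update_self]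

end Extension

/-! ### Descent to smaller subspaces -/

section Descent

variable {F V F' V' : Type*} [Field F] [AddCommGroup V] [Module F V]
  [Field F'] [AddCommGroup V'] [Module F' V'] {n k : ℕ} {Ω : LinearMap.BilinForm F V}
  {Ω' : LinearMap.BilinForm F' V'}

lemma frameSpan_insert (v : Fin n × Bool → V) (r : Fin n × Bool) (P : Set (Fin n × Bool)) :
    frameSpan F v (insert r P) = frameSpan F v P ⊔ Submodule.span F {v r} := by
  rw [frameSpan, Set.image_insert_eq, Submodule.span_insert, sup_comm]
  rfl

lemma frameSpan_mono (v : Fin n × Bool → V) {P Q : Set (Fin n × Bool)} (h : P ⊆ Q) :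
    frameSpan F v P ≤ frameSpan F v Q :=
  Submodule.span_mono (Set.image_mono h)

lemma sup_span_eq_of_finrank [Module.Finite F V] {H U : Submodule F V} (hHU : H ≤ U) {m : ℕ}
    (hH : Module.finrank F H = m) (hU : Module.finrank F U = m + 1) {x : V} (hx : x ∉ H)
    (hxU : x ∈ U) : H ⊔ Submodule.span F {x} = U := by
  refine Submodule.eq_of_le_of_finrank_eq
    (sup_le hHU ((Submodule.span_singleton_le_iff_mem _ _).2 hxU)) ?_
  rw [Submodule.finrank_sup_span_singleton hx, hH, hU]

lemma exists_frame_face (hΩ : Ω.IsAlt) (hΩn : Ω.Nondegenerate) (hn : 0 < n)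
    (hV : Module.finrank F V = 2 * n) (S : Grassmannian Ω k) :
    ∃ (v : Fin n × Bool → V) (hv : IsFrame Ω v) (A : Face n k), hv.face A = S := by
  obtain ⟨v, hv, P, hP⟩ := exists_frameSpan_eq hΩ hΩn hn hV S.2.2
  obtain ⟨A, -, hA⟩ := hv.exists_face hP
  exact ⟨v, hv, A, hA⟩

/-- The image of two adjacent subspaces is a pair of adjacent subspaces. -/
lemma InducedOnFrames.finrank_inf (hΩ : Ω.IsAlt) (hΩn : Ω.Nondegenerate) (hn : 0 < n)
    (hV : Module.finrank F V = 2 * n) {f : Grassmannian Ω (k + 1) → Grassmannian Ω' (k + 1)}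
    (hf : InducedOnFrames n f) (H : Grassmannian Ω k) {U S : Grassmannian Ω (k + 1)}
    (hU : H.1 ≤ U.1) (hS : H.1 ≤ S.1) (hne : U ≠ S) :
    Module.finrank F' ((f U).1 ⊓ (f S).1 : Submodule F' V') = k + 1 := by
  classical
  have hfin : Module.Finite F V := Module.finite_of_finrank_pos (by omega)
  have hex : ∀ W : Grassmannian Ω (k + 1), H.1 ≤ W.1 → ∃ x ∈ W.1, x ∉ H.1 := by
    intro W hW
    by_contra! h
    have := Submodule.finrank_mono (show W.1 ≤ H.1 from h)
    rw [W.2.1, H.2.1] at this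
    omega
  have horth : ∀ W : Grassmannian Ω (k + 1), H.1 ≤ W.1 → ∀ x ∈ W.1, ∀ z ∈ H.1, Ω x z = 0 :=
    fun W hW x hx z hz => isTotallyIsotropic_iff.1 W.2.2 x hx z (hW hz)
  obtain ⟨x, hxU, hxH⟩ := hex U hU
  obtain ⟨y, hyS, hyH⟩ := hex S hS
  have hUx := sup_span_eq_of_finrank hU H.2.1 U.2.1 hxH hxU
  have hSy := sup_span_eq_of_finrank hS H.2.1 S.2.1 hyH hyS
  have hyU : y ∉ U.1 := fun h =>
    hne (Subtype.ext ((sup_span_eq_of_finrank hU H.2.1 U.2.1 hyH h).symm.trans hSy))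
  obtain ⟨v, hv, P, r, s, hP, rfl, rfl⟩ := exists_frame_of_pair hΩ hΩn hn hV H.2.2
    (horth U hU x hxU) (horth S hS y hyS) hxH (by rwa [hUx])
  rw [hP, ← frameSpan_insert] at hUx hSy
  obtain ⟨A, hA, -⟩ := hv.exists_face hP
  obtain ⟨B, hB, hBU⟩ := hv.exists_face hUx.symm
  obtain ⟨C, hC, hCS⟩ := hv.exists_face hSy.symm
  have hinter : (B.1 : Set (Fin n × Bool)) ∩ C.1 = A.1 := by
    rw [hA, hB, hC]
    ext t
    constructor
    · rintro ⟨rfl | h1, rfl | h2⟩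
      · exact absurd hxU hyU
      · exact h2
      · exact h1
      · exact h1
    · exact fun h => ⟨Or.inr h, Or.inr h⟩
  obtain ⟨v', hv', hf'⟩ := hf v hv
  rw [← hBU, ← hCS, hf', hf', hv'.face_val, hv'.face_val, ← hv'.frameSpan_inter, hinter,
    hv'.finrank_frameSpan, A.2.1]

lemma Face.exists_notMem (hkn : k + 1 < n) (A : Face n k) :
    ∃ r, r ∉ A.1 ∧ antip r ∉ A.1 := by
  classical
  have h : (A.1.image Prod.fst).card < Fintype.card (Fin n) := by
    rw [Fintype.card_fin]
    exact (Finset.card_image_le.trans_eq A.2.1).trans_lt hkn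
  obtain ⟨i, hi⟩ : ∃ i, i ∉ A.1.image Prod.fst := by
    by_contra! h'
    exact h.ne ((Finset.card_eq_iff_eq_univ _).2 (Finset.eq_univ_iff_forall.2 h'))
  exact ⟨(i, true), fun h => hi (Finset.mem_image.2 ⟨_, h, rfl⟩),
    fun h => hi (Finset.mem_image.2 ⟨_, h, rfl⟩)⟩

/-- The face obtained by adding a vertex. -/
def Face.cons (A : Face n k) (r : Fin n × Bool) (h : r ∉ A.1) (h' : antip r ∉ A.1) :
    Face n (k + 1) :=
  ⟨Finset.cons r A.1 h, by rw [Finset.card_cons, A.2.1], by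
    intro s hs hs'
    rw [Finset.mem_cons] at hs hs'
    rcases hs with rfl | hs <;> rcases hs' with hs' | hs'
    · exact antip_ne _ hs'
    · exact h' hs'
    · exact h' (by rwa [← hs', antip_antip])
    · exact A.2.2 s hs hs'⟩

lemma Face.mem_cons {A : Face n k} {r s : Fin n × Bool} {h : r ∉ A.1} {h' : antip r ∉ A.1} :
    s ∈ (A.cons r h h').1 ↔ s = r ∨ s ∈ A.1 := by
  simp [Face.cons]

lemma IsFrame.face_le_cons {v : Fin n × Bool → V} (hv : IsFrame Ω v) (A : Face n k)
    (r : Fin n × Bool) (h : r ∉ A.1) (h' : antip r ∉ A.1) :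
    (hv.face A).1 ≤ (hv.face (A.cons r h h')).1 :=
  frameSpan_mono v fun _ ht => Face.mem_cons.2 (Or.inr ht)

lemma IsFrame.face_cons_inf {v : Fin n × Bool → V} (hv : IsFrame Ω v) (A : Face n k)
    (r : Fin n × Bool) (h : r ∉ A.1) (h' : antip r ∉ A.1) (h'' : antip (antip r) ∉ A.1) :
    (hv.face (A.cons r h h')).1 ⊓ (hv.face (A.cons (antip r) h' h'')).1 = (hv.face A).1 := by
  rw [face_val, face_val, ← hv.frameSpan_inter, face_val]
  congr 1
  ext t
  rw [Set.mem_inter_iff, Finset.mem_coe, Finset.mem_coe, Face.mem_cons, Face.mem_cons]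
  constructor
  · rintro ⟨rfl | h1, h2 | h2⟩
    · exact absurd h2 (ne_antip _)
    · exact h2
    · exact h1
    · exact h1
  · exact fun h => ⟨Or.inr h, Or.inr h⟩

/-- All images of subspaces through `H` contain a common subspace, of the same dimension as `H`.
If two of them, `S` and `T`, are spanned by `H` and non-orthogonal vectors, the common subspace is
`f S ⊓ f T`: a subspace adjacent to both `f S` and `f T` contains it, for otherwise `f S` and `f T`
would be orthogonal. -/
lemma InducedOnFrames.exists_le (hΩ : Ω.IsAlt) (hΩn : Ω.Nondegenerate) (hkn : k + 1 < n)
    (hV : Module.finrank F V = 2 * n) (hV' : Module.finrank F' V' = 2 * n)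
    {f : Grassmannian Ω (k + 1) → Grassmannian Ω' (k + 1)}
    (hf : InducedOnFrames n f) (H : Grassmannian Ω k) :
    ∃ E : Grassmannian Ω' k, ∀ U : Grassmannian Ω (k + 1), H.1 ≤ U.1 → E.1 ≤ (f U).1 := by
  have hn : 0 < n := by omega
  have hfin' : Module.Finite F' V' := Module.finite_of_finrank_pos (by omega)
  obtain ⟨v, hv, A, rfl⟩ := exists_frame_face hΩ hΩn hn hV H
  obtain ⟨v', hv', hf'⟩ := hf v hv
  obtain ⟨r, hr, hr'⟩ := A.exists_notMem hkn
  have hr'' : antip (antip r) ∉ A.1 := by rwa [antip_antip]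
  set S := hv.face (A.cons r hr hr') with hS
  set T := hv.face (A.cons (antip r) hr' hr'') with hT
  have hfS : f S = hv'.face (A.cons r hr hr') := hf' _
  have hfT : f T = hv'.face (A.cons (antip r) hr' hr'') := hf' _
  have hES : (hv'.face A).1 ≤ (f S).1 := hfS ▸ hv'.face_le_cons A r hr hr'
  have hET : (hv'.face A).1 ≤ (f T).1 := hfT ▸ hv'.face_le_cons A (antip r) hr' hr''
  refine ⟨hv'.face A, fun U hU => ?_⟩
  by_cases hUS : U = S
  · rwa [hUS]
  by_cases hUT : U = T
  · rwa [hUT]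
  by_contra hE
  set E := (hv'.face A).1 with hEdef
  have hsup : ∀ W : Grassmannian Ω (k + 1), (hv.face A).1 ≤ W.1 → U ≠ W → E ≤ (f W).1 →
      E ⊔ ((f U).1 ⊓ (f W).1) = (f W).1 := by
    intro W hW hUW hEW
    have hdim := hf.finrank_inf hΩ hΩn hn hV (hv.face A) hU hW hUW
    refine Submodule.eq_of_le_of_finrank_le (sup_le hEW inf_le_right) ?_
    have hlt : (f U).1 ⊓ (f W).1 < E ⊔ ((f U).1 ⊓ (f W).1) :=
      lt_of_le_of_ne le_sup_right fun h => hE (le_sup_left.trans (h.symm.le.trans inf_le_left))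
    have := Submodule.finrank_lt_finrank_of_lt hlt
    rw [hdim] at this
    rw [(f W).2.1]
    omega
  have hS1 := hsup S (hv.face_le_cons A r hr hr') hUS hES
  have hT1 := hsup T (hv.face_le_cons A (antip r) hr' hr'') hUT hET
  have hS2 := isTotallyIsotropic_iff.1 (f S).2.2
  have hT2 := isTotallyIsotropic_iff.1 (f T).2.2
  have hU2 := isTotallyIsotropic_iff.1 (f U).2.2
  have horth : ∀ x ∈ (f S).1, ∀ y ∈ (f T).1, Ω' x y = 0 := by
    intro x hx y hy
    rw [← hS1] at hx
    obtain ⟨e, he, a, ha, rfl⟩ := Submodule.mem_sup.1 hx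
    rw [map_add, LinearMap.add_apply, hT2 e (hET he) y hy, zero_add]
    rw [← hT1] at hy
    obtain ⟨e', he', b, hb, rfl⟩ := Submodule.mem_sup.1 hy
    rw [map_add, hS2 a ha.2 e' (hES he'), hU2 a ha.1 b hb.1, add_zero]
  refine hv'.apply_antip r (horth _ ?_ _ ?_)
  · rw [hfS]
    exact subset_frameSpan (Face.mem_cons.2 (Or.inl rfl))
  · rw [hfT]
    exact subset_frameSpan (Face.mem_cons.2 (Or.inl rfl))

/-- A map induced on frames descends to the subspaces of one dimension less. -/
lemma InducedOnFrames.exists_descent (hΩ : Ω.IsAlt) (hΩn : Ω.Nondegenerate) (hkn : k + 1 < n)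
    (hV : Module.finrank F V = 2 * n) (hV' : Module.finrank F' V' = 2 * n)
    {f : Grassmannian Ω (k + 1) → Grassmannian Ω' (k + 1)} (hf : InducedOnFrames n f) :
    ∃ g : Grassmannian Ω k → Grassmannian Ω' k,
      (∀ H U, H.1 ≤ U.1 → (g H).1 ≤ (f U).1) ∧
      ∀ (v : Fin n × Bool → V) (hv : IsFrame Ω v) (v' : Fin n × Bool → V') (hv' : IsFrame Ω' v'),
        (∀ A, f (hv.face A) = hv'.face A) → ∀ A, g (hv.face A) = hv'.face A := by
  have hfin' : Module.Finite F' V' := Module.finite_of_finrank_pos (by omega)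
  choose g hg using hf.exists_le hΩ hΩn hkn hV hV'
  refine ⟨g, fun H U => hg H U, fun v hv v' hv' hf' A => ?_⟩
  obtain ⟨r, hr, hr'⟩ := A.exists_notMem hkn
  have hr'' : antip (antip r) ∉ A.1 := by rwa [antip_antip]
  have h1 := hg _ _ (hv.face_le_cons A r hr hr')
  have h2 := hg _ _ (hv.face_le_cons A (antip r) hr' hr'')
  rw [hf'] at h1 h2
  have h3 := (le_inf h1 h2).trans_eq (hv'.face_cons_inf A r hr hr' hr'')
  exact Subtype.ext (Submodule.eq_of_le_of_finrank_eq h3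
    (by rw [(g _).2.1, (hv'.face A).2.1]))

lemma IsFrame.face_of_eq_singleton {v : Fin n × Bool → V} (hv : IsFrame Ω v) {A : Face n k}
    {r : Fin n × Bool} (h : A.1 = {r}) : (hv.face A).1 = (hv.point r).submodule := by
  rw [face_val, submodule_point, frameSpan, h, Finset.coe_singleton, Set.image_singleton]

/-- The map of points obtained by repeated descent. -/
lemma InducedOnFrames.exists_point_map (hΩ : Ω.IsAlt) (hΩn : Ω.Nondegenerate) (hkn : k < n)
    (hV : Module.finrank F V = 2 * n) (hV' : Module.finrank F' V' = 2 * n)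
    {f : Grassmannian Ω k → Grassmannian Ω' k} (hf : InducedOnFrames n f) :
    ∃ h : ℙ F V → ℙ F' V', (∀ S : Grassmannian Ω k, ∀ p : ℙ F V, p.submodule ≤ S.1 →
        (h p).submodule ≤ (f S).1) ∧
      ∀ (v : Fin n × Bool → V) (hv : IsFrame Ω v) (v' : Fin n × Bool → V') (hv' : IsFrame Ω' v'),
        (∀ A, f (hv.face A) = hv'.face A) → ∀ r, h (hv.point r) = hv'.point r := by
  have hfin : Module.Finite F V := Module.finite_of_finrank_pos (by omega)
  induction k with
  | zero =>
    have hiso : ∀ p : ℙ F V, IsTotallyIsotropic Ω p.submodule := by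
      intro p
      rw [isTotallyIsotropic_iff, p.submodule_eq]
      intro x hx y hy
      obtain ⟨c, rfl⟩ := Submodule.mem_span_singleton.1 hx
      obtain ⟨d, rfl⟩ := Submodule.mem_span_singleton.1 hy
      simp [hΩ p.rep]
    let G : ℙ F V → Grassmannian Ω 0 := fun p => ⟨p.submodule, p.finrank_submodule, hiso p⟩
    have hsub : ∀ p, (Projectivization.mk'' (f (G p)).1 (f (G p)).2.1).submodule = (f (G p)).1 :=
      fun p => Projectivization.submodule_mk'' _ _
    refine ⟨fun p => Projectivization.mk'' (f (G p)).1 (f (G p)).2.1, fun S p hp => ?_,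
      fun v hv v' hv' hf' r => ?_⟩
    · rw [hsub]
      have : G p = S := Subtype.ext
        (Submodule.eq_of_le_of_finrank_eq hp (by rw [S.2.1, p.finrank_submodule]))
      rw [this]
    · let A : Face n 0 := ⟨{r}, by simp, by simp [antip_ne]⟩
      have hG : G (hv.point r) = hv.face A := Subtype.ext (hv.face_of_eq_singleton rfl).symm
      apply Projectivization.submodule_injective
      rw [hsub, hG, hf', hv'.face_of_eq_singleton rfl]
  | succ k ih =>
    obtain ⟨g, hg1, hg2⟩ := hf.exists_descent hΩ hΩn hkn hV hV'
    have hg : InducedOnFrames n g := fun v hv => by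
      obtain ⟨v', hv', hf'⟩ := hf v hv
      exact ⟨v', hv', hg2 v hv v' hv' hf'⟩
    obtain ⟨h, h1, h2⟩ := ih (by omega) hg
    refine ⟨h, fun S p hp => ?_, fun v hv v' hv' hf' => h2 v hv v' hv' (hg2 v hv v' hv' hf')⟩
    -- a subspace of dimension one less between the point and `S`
    obtain ⟨H, hpH, hHS, hH⟩ : ∃ H : Submodule F V, p.submodule ≤ H ∧ H ≤ S.1 ∧
        Module.finrank F H = k + 1 := by
      have key : ∀ j ≤ k, ∃ H : Submodule F V, p.submodule ≤ H ∧ H ≤ S.1 ∧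
          Module.finrank F H = j + 1 := by
        intro j
        induction j with
        | zero => exact fun _ => ⟨p.submodule, le_rfl, hp, p.finrank_submodule⟩
        | succ j ihj =>
          intro hj
          obtain ⟨H, hpH, hHS, hH⟩ := ihj (by omega)
          obtain ⟨x, hxS, hxH⟩ : ∃ x ∈ S.1, x ∉ H := by
            by_contra! h'
            have := Submodule.finrank_mono (show S.1 ≤ H from h')
            rw [S.2.1, hH] at this
            omega
          exact ⟨H ⊔ Submodule.span F {x}, hpH.trans le_sup_left,
            sup_le hHS ((Submodule.span_singleton_le_iff_mem _ _).2 hxS),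
            by rw [Submodule.finrank_sup_span_singleton hxH, hH]⟩
      exact key k le_rfl
    have hHiso : IsTotallyIsotropic Ω H :=
      fun q hq q' hq' => S.2.2 q (le_trans hq hHS) q' (le_trans hq' hHS)
    exact (h1 ⟨H, hH, hHiso⟩ p hpH).trans (hg1 ⟨H, hH, hHiso⟩ S hHS)

end Descent

/-! ### The embedding -/

section Embedding

variable {F V F' V' : Type*} [Field F] [AddCommGroup V] [Module F V]
  [Field F'] [AddCommGroup V'] [Module F' V'] {n : ℕ} {Ω : LinearMap.BilinForm F V}
  {Ω' : LinearMap.BilinForm F' V'} {h : ℙ F V → ℙ F' V'}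

/-- Two distinct points belong to a common frame. -/
lemma exists_frame_points (hΩ : Ω.IsAlt) (hΩn : Ω.Nondegenerate) (hn : 0 < n)
    (hV : Module.finrank F V = 2 * n) {p q : ℙ F V} (hpq : p ≠ q) :
    ∃ (v : Fin n × Bool → V) (hv : IsFrame Ω v) (r s : Fin n × Bool),
      hv.point r = p ∧ hv.point s = q := by
  have hq : q.rep ∉ (⊥ : Submodule F V) ⊔ Submodule.span F {p.rep} := by
    rw [bot_sup_eq, Submodule.mem_span_singleton]
    rintro ⟨c, hc⟩
    apply hpq
    rw [← p.mk_rep, ← q.mk_rep, eq_comm, Projectivization.mk_eq_mk_iff']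
    exact ⟨c, hc⟩
  obtain ⟨v, hv, P, r, s, -, hr, hs⟩ := exists_frame_of_pair hΩ hΩn hn hV (H := ⊥)
    (isTotallyIsotropic_iff.2 (by simp)) (x := p.rep) (y := q.rep) (by simp) (by simp)
    (by simpa using p.rep_nonzero) hq
  refine ⟨v, hv, r, s, ?_, ?_⟩
  · rw [← p.mk_rep]
    simp only [IsFrame.point, hr]
  · rw [← q.mk_rep]
    simp only [IsFrame.point, hs]

/-- A map of points which sends every frame to a frame. -/
def MapsFrames (n : ℕ) (Ω : LinearMap.BilinForm F V) (Ω' : LinearMap.BilinForm F' V')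
    (h : ℙ F V → ℙ F' V') : Prop :=
  ∀ (v : Fin n × Bool → V) (hv : IsFrame Ω v), ∃ (v' : Fin n × Bool → V') (hv' : IsFrame Ω' v'),
    ∀ r, h (hv.point r) = hv'.point r

lemma MapsFrames.injective (hh : MapsFrames n Ω Ω' h) (hΩ : Ω.IsAlt) (hΩn : Ω.Nondegenerate)
    (hn : 0 < n) (hV : Module.finrank F V = 2 * n) : Function.Injective h := by
  intro p q hpq
  by_contra hne
  obtain ⟨v, hv, r, s, rfl, rfl⟩ := exists_frame_points hΩ hΩn hn hV hne
  obtain ⟨v', hv', hh'⟩ := hh v hv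
  rw [hh', hh', hv'.point_injective.eq_iff] at hpq
  exact hne (by rw [hpq])

lemma MapsFrames.pointOrthogonal_iff (hh : MapsFrames n Ω Ω' h) (hΩ : Ω.IsAlt)
    (hΩn : Ω.Nondegenerate) (hΩ' : Ω'.IsAlt) (hn : 0 < n) (hV : Module.finrank F V = 2 * n)
    (p q : ℙ F V) : PointOrthogonal Ω' (h p) (h q) ↔ PointOrthogonal Ω p q := by
  by_cases hpq : p = q
  · subst hpq
    rw [pointOrthogonal_iff_rep, pointOrthogonal_iff_rep, hΩ, hΩ']
    exact iff_of_true rfl rfl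
  · obtain ⟨v, hv, r, s, rfl, rfl⟩ := exists_frame_points hΩ hΩn hn hV hpq
    obtain ⟨v', hv', hh'⟩ := hh v hv
    rw [hh', hh', ← not_iff_not, hv'.pointOrthogonal_point, hv.pointOrthogonal_point]

lemma IsFrame.submodule_le_frameSpan {v : Fin n × Bool → V} (hv : IsFrame Ω v)
    {P : Set (Fin n × Bool)} (p : ℙ F V) :
    p.submodule ≤ frameSpan F v P ↔ ∀ s ∉ P, PointOrthogonal Ω p (hv.point (antip s)) := by
  rw [p.submodule_eq, Submodule.span_singleton_le_iff_mem, hv.mem_frameSpan]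
  refine forall₂_congr fun s _ => ?_
  conv_rhs => rw [← p.mk_rep]
  rw [point, pointOrthogonal_mk]

/-- A point lies on the span of a part of a frame if and only if the same holds for the images:
both statements are systems of orthogonality relations. -/
lemma MapsFrames.submodule_le_iff (hh : MapsFrames n Ω Ω' h) (hΩ : Ω.IsAlt)
    (hΩn : Ω.Nondegenerate) (hΩ' : Ω'.IsAlt) (hn : 0 < n) (hV : Module.finrank F V = 2 * n)
    {v : Fin n × Bool → V} {hv : IsFrame Ω v} {v' : Fin n × Bool → V'} {hv' : IsFrame Ω' v'}
    (hh' : ∀ r, h (hv.point r) = hv'.point r) {P : Set (Fin n × Bool)} (p : ℙ F V) :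
    (h p).submodule ≤ frameSpan F' v' P ↔ p.submodule ≤ frameSpan F v P := by
  rw [hv'.submodule_le_frameSpan, hv.submodule_le_frameSpan]
  refine forall₂_congr fun s _ => ?_
  rw [← hh', hh.pointOrthogonal_iff hΩ hΩn hΩ' hn hV]

/-- A map of points which sends frames to frames is a symplectic embedding: lines are spanned by
pairs of vectors of frames, so they are preserved as sets of solutions of orthogonality
relations. -/
theorem MapsFrames.isSymplecticEmbedding (hh : MapsFrames n Ω Ω' h) (hΩ : Ω.IsAlt)
    (hΩn : Ω.Nondegenerate) (hΩ' : Ω'.IsAlt) (hn : 0 < n) (hV : Module.finrank F V = 2 * n)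
    (hV' : Module.finrank F' V' = 2 * n) : IsSymplecticEmbedding Ω Ω' h := by
  have hfin : Module.Finite F V := Module.finite_of_finrank_pos (by omega)
  have hfin' : Module.Finite F' V' := Module.finite_of_finrank_pos (by omega)
  have hmem : ∀ {S : Submodule F V} {x : V} (hx : x ≠ 0), x ∈ S →
      Projectivization.mk F x hx ∈ pointsOf S := by
    intro S x hx hxS
    rw [pointsOf, Set.mem_ofPred_eq, Projectivization.submodule_mk]
    exact (Submodule.span_singleton_le_iff_mem _ _).2 hxS
  -- each line is spanned by two vectors of a frame
  have hline : ∀ W : Submodule F V, Module.finrank F W = 2 →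
      ∃ (v : Fin n × Bool → V) (_ : IsFrame Ω v) (A : Finset (Fin n × Bool)),
        A.card = 2 ∧ W = frameSpan F v A := by
    intro W hW
    obtain ⟨x, y, hxW, hyW, hx, hxy⟩ : ∃ x y, x ∈ W ∧ y ∈ W ∧ x ≠ 0 ∧
        y ∉ (⊥ : Submodule F V) ⊔ Submodule.span F {x} := by
      have hWb : W ≠ ⊥ := by
        rintro rfl
        rw [finrank_bot] at hW
        omega
      obtain ⟨x, hx, hx0⟩ := Submodule.exists_mem_ne_zero_of_ne_bot hWb
      by_contra! h'
      have h1 : W ≤ Submodule.span F {x} := fun y hy => by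
        have := h' x y hx hy hx0
        rwa [bot_sup_eq] at this
      have h2 := Submodule.finrank_mono h1
      rw [hW, finrank_span_singleton hx0] at h2
      omega
    obtain ⟨v, hv, P, r, s, -, rfl, rfl⟩ := exists_frame_of_pair hΩ hΩn hn hV (H := ⊥)
      (isTotallyIsotropic_iff.2 (by simp)) (x := x) (y := y) (by simp) (by simp)
      (by simpa using hx) hxy
    have hrs : r ≠ s := by
      rintro rfl
      exact hxy (by rw [bot_sup_eq]; exact Submodule.mem_span_singleton_self _)
    refine ⟨v, hv, {r, s}, Finset.card_pair hrs, ?_⟩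
    refine (Submodule.eq_of_le_of_finrank_eq ?_ ?_).symm
    · rw [frameSpan_le]
      intro t ht
      rw [Finset.mem_coe, Finset.mem_insert, Finset.mem_singleton] at ht
      rcases ht with rfl | rfl <;> assumption
    · rw [hv.finrank_frameSpan, Finset.card_pair hrs, hW]
  refine ⟨⟨hh.injective hΩ hΩn hn hV, ?_, ?_⟩, ?_⟩
  · rintro _ ⟨W, hW, rfl⟩
    obtain ⟨v, hv, A, hA, rfl⟩ := hline W hW
    obtain ⟨v', hv', hh'⟩ := hh v hv
    refine ⟨pointsOf (frameSpan F' v' A), ⟨_, by rw [hv'.finrank_frameSpan, hA], rfl⟩, ?_⟩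
    rintro _ ⟨p, hp, rfl⟩
    exact (hh.submodule_le_iff hΩ hΩn hΩ' hn hV hh' p).2 hp
  · rintro _ ⟨W', hW', rfl⟩ _ _ ⟨W₁, hW₁, rfl⟩ ⟨W₂, hW₂, rfl⟩ h₁ h₂
    obtain ⟨v, hv, A, hA, rfl⟩ := hline W₁ hW₁
    obtain ⟨v', hv', hh'⟩ := hh v hv
    -- the image of the first line spans `W'`
    have hWA : frameSpan F' v' A = W' := by
      refine Submodule.eq_of_le_of_finrank_eq ?_ (by rw [hv'.finrank_frameSpan, hA, hW'])
      rw [frameSpan_le]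
      intro r hr
      have h3 : (h (hv.point r)).submodule ≤ W' :=
        h₁ ⟨_, hmem (hv.ne_zero r) (subset_frameSpan hr), rfl⟩
      rwa [hh', hv'.submodule_point, Submodule.span_singleton_le_iff_mem] at h3
    have hle : W₂ ≤ frameSpan F v A := by
      intro x hx
      by_cases hx0 : x = 0
      · rw [hx0]; exact Submodule.zero_mem _
      have h3 : (h (Projectivization.mk F x hx0)).submodule ≤ W' := h₂ ⟨_, hmem hx0 hx, rfl⟩
      rw [← hWA, hh.submodule_le_iff hΩ hΩn hΩ' hn hV hh', Projectivization.submodule_mk,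
        Submodule.span_singleton_le_iff_mem] at h3
      exact h3
    rw [Submodule.eq_of_le_of_finrank_eq hle (by rw [hW₂, hW₁])]
  · intro B hB
    obtain ⟨v, hv, rfl⟩ := hB.exists_frame hn hV hΩ
    obtain ⟨v', hv', hh'⟩ := hh v hv
    have : h '' Set.range hv.point = Set.range hv'.point := by
      rw [← Set.range_comp]
      exact congrArg Set.range (funext hh')
    rw [this]
    exact hv'.isSymplecticBase

end Embedding

end SymplecticGrassmannian

theorem theorem1 {F V F' V' : Type*} [Field F] [AddCommGroup V] [Module F V]
    [Field F'] [AddCommGroup V'] [Module F' V'] (n k : ℕ) (hk : k < n)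
    (hV : Module.finrank F V = 2 * n) (hV' : Module.finrank F' V' = 2 * n)
    (Ω : LinearMap.BilinForm F V) (hΩalt : Ω.IsAlt) (hΩ : Ω.Nondegenerate)
    (Ω' : LinearMap.BilinForm F' V') (hΩalt' : Ω'.IsAlt) (hΩ' : Ω'.Nondegenerate)
    (f : SymplecticGrassmannian.Grassmannian Ω k → SymplecticGrassmannian.Grassmannian Ω' k)
    (hf : ∀ X : Set (SymplecticGrassmannian.Grassmannian Ω k),
      SymplecticGrassmannian.IsBaseSubset Ω k X →
        SymplecticGrassmannian.IsBaseSubset Ω' k (f '' X)) :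
    ∃ h : ℙ F V → ℙ F' V',
      SymplecticGrassmannian.IsSymplecticEmbedding Ω Ω' h ∧
        SymplecticGrassmannian.IsInducedBy f h := by
  open SymplecticGrassmannian in
  have hn : 0 < n := by omega
  have hframes : InducedOnFrames n f :=
    (permutesFaces_of_isBaseSubset hn hV' hΩalt' hf).inducedOnFrames hΩalt hk hV hV'
  obtain ⟨h, hle, hpoint⟩ := hframes.exists_point_map hΩalt hΩ hk hV hV'
  have hh : MapsFrames n Ω Ω' h := fun v hv => by
    obtain ⟨v', hv', hf'⟩ := hframes v hv
    exact ⟨v', hv', hpoint v hv v' hv' hf'⟩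
  refine ⟨h, hh.isSymplecticEmbedding hΩalt hΩ hΩalt' hn hV hV', fun S => ?_⟩
  apply le_antisymm
  · obtain ⟨v, hv, A, rfl⟩ := exists_frame_face hΩalt hΩ hn hV S
    obtain ⟨v', hv', hf'⟩ := hframes v hv
    rw [hf', hv'.face_val, ← hv'.pointSpan_image]
    refine biSup_mono ?_
    rintro _ ⟨r, hr, rfl⟩
    refine ⟨hv.point r, ?_, hpoint v hv v' hv' hf' r⟩
    rw [pointsOf, Set.mem_ofPred_eq, hv.submodule_point, Submodule.span_singleton_le_iff_mem]
    exact subset_frameSpan hr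
  · refine iSup₂_le ?_
    rintro _ ⟨p, hp, rfl⟩
    exact hle S p hp
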